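/- Let $\hbar, M, L>0$ and $\nu,\beta\ge 0$ be real, and put $\varepsilon_0=\hbar^2\pi^2/(2ML^2)$ and, for $n\in\mathbb N=\{0,1,2,\dots\}$, $$E_n=\varepsilon_0\Big((n+\nu+1)^2-\frac{\beta^2}{(n+\nu+1)^2}\Big),\qquad a_n=-(n+\nu+1)+\frac{i\beta}{n+\nu+1},$$ $$\phi_n(x)=K_n\,\sin^{\nu+n+1}\!\Big(\frac{\pi x}{L}\Big)\exp\!\Big(-\frac{\beta\pi x}{L(\nu+n+1)}\Big)P_n^{(a_n,\bar a_n)}\!\Big(i\cot\frac{\pi x}{L}\Big),\qquad 0<x<L,$$ where $P_n^{(a,b)}$ are the Jacobi polynomials and $K_n>0$ is the normalization constant for which $\int_0^L|\phi_n|^2\,dx=1$. (These are the eigenvalues and normalized eigenfunctions of the Pöschl–Teller Hamiltonian $-\frac{\hbar^2}{2M}\frac{d^2}{dx^2}+\varepsilon_0\big(\frac{\nu(\nu+1)}{\sin^2(\pi x/L)}-2\beta\cot\frac{\pi x}{L}\big)$ on $L^2([0,L])$.) Define recursively, for $m=0,1,2,\dots$, the hierarchic eigenfunctions $\phi^{(m)}_n$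 (with $\phi_n^{(0)}=\phi_n$), the superpotentials $W_m$ and the operators $A_m$ by $$\phi^{(m)}_n=\frac{A_{m-1}\cdots A_1A_0\,\phi_{n+m}}{\sqrt{(2M)^m\prod_{k=0}^{m-1}(E_{n+m}-E_k)}},\qquad W_m=-\hbar\,\frac{(\phi^{(m)}_0)'}{\phi^{(m)}_0},\qquad A_m=\hbar\frac{d}{dx}+W_m .$$ As an operator in $L^2([0,L])$, $A_m$ acts on the functions $u\in L^2([0,L])$ that are absolutely continuous on every compact subinterval of $(0,L)$ and satisfy $\hbar u'+W_mu\in L^2([0,L])$. Let $\dagger$ denote the Hilbert space adjoint, let products of operators have their natural domains, and put $${}_{m+1}\Lambda_n=A_nA_{n-1}\cdots A_{m+1}\quad(m<n),\qquad {}^{n+1}\Theta_m=A_{n+1}^\dagger A_{n+2}^\dagger\cdots A_m^\dagger\quad(n<m).$$ For $n,m\in\mathbb N$ let $\mathcal M(n,m)\ge 0$ and $\mathcal N(n,m)$ be given by $$\mathcal M^2(n,m)=\prod_{k=0}^{m}(n+m-k+1)(n+m+2\nu+k+3)\Big(1+\frac{\beta^2}{[(k+\nu+1)(n+m+\nu+2)]^2}\Big),$$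 $$\mathcal N(n,m)=\prod_{k=0}^{m}(2n-k+1)(2n+2\nu+k+3)\Big(1+\frac{\beta^2}{[(k+\nu+1)(2n+\nu+2)]^2}\Big).$$ For an operator $X$ and a function $\phi$ in its domain write $\langle X\rangle_\phi=\int_0^L\overline{\phi}\,X\phi\,dx$. Then the following mean values exist (each state lies in the domain of the operator in question) and are given as follows. If $m<n$, $$\big\langle {}_{m+1}\Lambda_n\,{}_{m+1}\Lambda_n^\dagger\big\rangle_{\phi^{(n+1)}_n}=\Big[\Big(\frac{\pi\hbar}{L}\Big)^{n-m}\Big]^2\,\mathcal N(n,n)\,\mathcal N^{-1}(n,m),$$ $$\big\langle {}_{m+1}\Lambda_n^\dagger\,{}_{m+1}\Lambda_n\big\rangle_{\phi^{(m+1)}_n}=\Big[\Big(\frac{\pi\hbar}{L}\Big)^{n-m}\mathcal M(m,n)\,\mathcal M^{-1}(n,m)\Big]^2;$$ if $n<m$, $$\big\langle {}^{n+1}\Theta_m\,{}^{n+1}\Theta_m^\dagger\big\rangle_{\phi^{(n+1)}_n}=\Big[\Big(\frac{\pi\hbar}{L}\Big)^{m-n}\Big]^2\,\mathcal N^{-1}(n,n)\,\mathcal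 N(n,m),$$ $$\big\langle {}^{n+1}\Theta_m^\dagger\,{}^{n+1}\Theta_m\big\rangle_{\phi^{(m+1)}_n}=\Big[\Big(\frac{\pi\hbar}{L}\Big)^{m-n}\mathcal M(n,m)\,\mathcal M^{-1}(m,n)\Big]^2.$$ Moreover $\mathcal N(n,n)=\mathcal M^2(n,n)$ for every $n\in\mathbb N$. -/

import Mathlib

open MeasureTheory
open scoped InnerProductSpace

namespace PoschlTeller

/-! ### The model -/

/-- The real parameters of the model: `ħ`, the particle mass, the length `L` of the interval,
and the dimensionless parameters `ν` and `β` of the potential. -/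
structure Params where
  hbar : ℝ
  mass : ℝ
  L : ℝ
  nu : ℝ
  beta : ℝ

/-- Lebesgue measure on the open interval `(0, L)`. -/
noncomputable def mu (L : ℝ) : Measure ℝ := volume.restrict (Set.Ioo 0 L)

/-- The Hilbert space `L²([0, L], dx)` of complex-valued functions. -/
abbrev Hilb (L : ℝ) : Type := Lp ℂ 2 (mu L)

/-- The energy scale `ε₀ = ħ² π² / (2 M L²)`. -/
noncomputable def Params.eps (p : Params) : ℝ :=
  p.hbar ^ 2 * Real.pi ^ 2 / (2 * p.mass * p.L ^ 2)

/-- The eigenvalues `E_n = ε₀ ((n + ν + 1)² - β² / (n + ν + 1)²)`. -/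
noncomputable def Params.energy (p : Params) (n : ℕ) : ℝ :=
  p.eps * ((n + p.nu + 1) ^ 2 - p.beta ^ 2 / (n + p.nu + 1) ^ 2)

/-! ### The eigenfunctions of the Pöschl-Teller Hamiltonian -/

/-- The Jacobi polynomial `P_n^{(a, b)}(z)`, for arbitrary complex parameters:
`∑_{k ≤ n} (n + a + b + 1)_k (a + k + 1)_{n - k} / (k! (n - k)!) ((z - 1) / 2)^k`. -/
noncomputable def jacobi (n : ℕ) (a b z : ℂ) : ℂ :=
  ∑ k ∈ Finset.range (n + 1),
    (ascPochhammer ℂ k).eval (n + a + b + 1) * (ascPochhammer ℂ (n - k)).eval (a + k + 1) /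
      ((k.factorial : ℂ) * ((n - k).factorial : ℂ)) * ((z - 1) / 2) ^ k

/-- The parameter `a_n = -(n + ν + 1) + i β / (n + ν + 1)`. -/
noncomputable def Params.a (p : Params) (n : ℕ) : ℂ :=
  -((n + p.nu + 1 : ℝ) : ℂ) + Complex.I * ((p.beta / (n + p.nu + 1) : ℝ) : ℂ)

/-- The eigenfunction before normalization,
`sin^{ν+n+1}(π x / L) exp(-β π x / (L (ν+n+1))) P_n^{(a_n, conj a_n)}(i cot(π x / L))`. -/
noncomputable def Params.rawEigenfun (p : Params) (n : ℕ) (x : ℝ) : ℂ :=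
  ((Real.sin (Real.pi * x / p.L) ^ (p.nu + n + 1) *
      Real.exp (-(p.beta * Real.pi * x / (p.L * (p.nu + n + 1)))) : ℝ) : ℂ) *
    jacobi n (p.a n) (starRingEnd ℂ (p.a n)) (Complex.I * (Real.cot (Real.pi * x / p.L) : ℂ))

/-- The normalization constant `K_n > 0`, which makes the eigenfunction a unit vector of
`L²([0, L])`. -/
noncomputable def Params.normConst (p : Params) (n : ℕ) : ℝ :=
  (Real.sqrt (∫ x in (0 : ℝ)..p.L, ‖p.rawEigenfun n x‖ ^ 2))⁻¹

/-- The normalized eigenfunction `φ_n`. -/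
noncomputable def Params.eigenfun (p : Params) (n : ℕ) (x : ℝ) : ℂ :=
  (p.normConst n : ℂ) * p.rawEigenfun n x

/-! ### The hierarchy -/

/-- The first order differential expression `ħ f' + W f`. -/
noncomputable def applyA (hbar : ℝ) (W f : ℝ → ℂ) (x : ℝ) : ℂ :=
  (hbar : ℂ) * deriv f x + W x * f x

/-- The superpotential `-ħ f' / f` that belongs to the ground state `f`. -/
noncomputable def superpotOf (hbar : ℝ) (f : ℝ → ℂ) (x : ℝ) : ℂ :=
  -(hbar : ℂ) * deriv f x / f x

/-- The constant `√((2M)^m ∏_{k < m} (E_j - E_k))`. -/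
noncomputable def Params.hierNorm (p : Params) (m j : ℕ) : ℝ :=
  Real.sqrt ((2 * p.mass) ^ m * ∏ k ∈ Finset.range m, (p.energy j - p.energy k))

/-- `ladder m j` is the function `A_{m-1} ⋯ A_1 A_0 φ_j`, where `A_k = ħ d/dx + W_k` and
`W_k = -ħ (φ_0^{(k)})' / φ_0^{(k)}` is built from the ground state
`φ_0^{(k)} = A_{k-1} ⋯ A_0 φ_k / √((2M)^k ∏_{i < k} (E_k - E_i))` of the previous stage. -/
noncomputable def Params.ladder (p : Params) : ℕ → ℕ → ℝ → ℂ
  | 0, j => p.eigenfun j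
  | m + 1, j =>
      applyA p.hbar
        (superpotOf p.hbar (fun x => p.ladder m m x / (p.hierNorm m m : ℂ)))
        (p.ladder m j)

/-- The hierarchic eigenfunction
`φ_n^{(m)} = A_{m-1} ⋯ A_1 A_0 φ_{n+m} / √((2M)^m ∏_{k < m} (E_{n+m} - E_k))`. -/
noncomputable def Params.hierEigenfun (p : Params) (m n : ℕ) (x : ℝ) : ℂ :=
  p.ladder m (n + m) x / (p.hierNorm m (n + m) : ℂ)

/-- The superpotential `W_m = -ħ (φ_0^{(m)})' / φ_0^{(m)}`. -/
noncomputable def Params.superpot (p : Params) (m : ℕ) : ℝ → ℂ :=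
  superpotOf p.hbar (p.hierEigenfun m 0)

theorem Params.ladder_succ (p : Params) (m j : ℕ) :
    p.ladder (m + 1) j = applyA p.hbar (p.superpot m) (p.ladder m j) := by
  have h : p.hierEigenfun m 0 = fun x => p.ladder m m x / (p.hierNorm m m : ℂ) := by
    funext x
    simp only [Params.hierEigenfun, zero_add]
  rw [Params.superpot, h, Params.ladder]

/-! ### The operators `A_m` and their products in `L²([0, L])` -/

/-- `f` is absolutely continuous on every compact subinterval of `(0, L)`, with (almost
everywhere) derivative `g`. -/
def HasACDeriv (L : ℝ) (f g : ℝ → ℂ) : Prop :=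
  ∀ a ∈ Set.Ioo 0 L, ∀ b ∈ Set.Ioo 0 L,
    IntervalIntegrable g volume a b ∧ f b - f a = ∫ t in a..b, g t

theorem HasACDeriv.add {L : ℝ} {f₁ g₁ f₂ g₂ : ℝ → ℂ} (h₁ : HasACDeriv L f₁ g₁)
    (h₂ : HasACDeriv L f₂ g₂) : HasACDeriv L (f₁ + f₂) (g₁ + g₂) := by
  intro a ha b hb
  obtain ⟨i₁, e₁⟩ := h₁ a ha b hb
  obtain ⟨i₂, e₂⟩ := h₂ a ha b hb
  refine ⟨i₁.add i₂, ?_⟩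
  have := intervalIntegral.integral_add i₁ i₂
  simp only [Pi.add_apply]
  rw [this, ← e₁, ← e₂]
  ring

theorem HasACDeriv.smul {L : ℝ} {f g : ℝ → ℂ} (c : ℂ) (h : HasACDeriv L f g) :
    HasACDeriv L (c • f) (c • g) := by
  intro a ha b hb
  obtain ⟨i, e⟩ := h a ha b hb
  refine ⟨i.smul c, ?_⟩
  have := intervalIntegral.integral_smul (μ := volume) (a := a) (b := b) c g
  simp only [Pi.smul_apply]
  rw [this, ← e, smul_sub]

/-- The graph of the operator `ħ d/dx + W` in `L²([0, L])` on its maximal domain: the pairs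
`(u, ħ u' + W u)` with `u` in `L²` absolutely continuous in `(0, L)` and `ħ u' + W u` in `L²`. -/
def graphA (L hbar : ℝ) (W : ℝ → ℂ) : Submodule ℂ (Hilb L × Hilb L) where
  carrier := {q | ∃ f g : ℝ → ℂ, HasACDeriv L f g ∧ q.1 =ᵐ[mu L] f ∧
    q.2 =ᵐ[mu L] fun x => (hbar : ℂ) * g x + W x * f x}
  zero_mem' := by
    refine ⟨0, 0, fun a _ b _ => ⟨?_, by simp⟩, Lp.coeFn_zero _ _ _, ?_⟩
    · exact intervalIntegrable_const
    · filter_upwards [Lp.coeFn_zero ℂ 2 (mu L)] with x hx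
      simpa using hx
  add_mem' := by
    rintro q r ⟨f₁, g₁, h₁, hu₁, hv₁⟩ ⟨f₂, g₂, h₂, hu₂, hv₂⟩
    refine ⟨f₁ + f₂, g₁ + g₂, h₁.add h₂, ?_, ?_⟩
    · filter_upwards [hu₁, hu₂, Lp.coeFn_add q.1 r.1] with x h1 h2 h3
      simp only [Prod.fst_add, h3, Pi.add_apply, h1, h2]
    · filter_upwards [hv₁, hv₂, Lp.coeFn_add q.2 r.2] with x h1 h2 h3
      simp only [Prod.snd_add, h3, Pi.add_apply, h1, h2]
      ring
  smul_mem' := by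
    rintro c q ⟨f, g, h, hu, hv⟩
    refine ⟨c • f, c • g, h.smul c, ?_, ?_⟩
    · filter_upwards [hu, Lp.coeFn_smul c q.1] with x h1 h3
      simp only [Prod.smul_fst, h3, Pi.smul_apply, h1]
    · filter_upwards [hv, Lp.coeFn_smul c q.2] with x h1 h3
      simp only [Prod.smul_snd, h3, Pi.smul_apply, h1, smul_eq_mul]
      ring

/-- The relation `graphA` is single-valued, hence really the graph of an operator. -/
theorem graphA_snd_eq_zero (L hbar : ℝ) (W : ℝ → ℂ) (q : Hilb L × Hilb L)
    (hq : q ∈ graphA L hbar W) (h0 : q.1 = 0) : q.2 = 0 := by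
  obtain ⟨f, g, h, hu, hv⟩ := hq
  have hf0 : ∀ᵐ x ∂(volume : Measure ℝ), x ∈ Set.Ioo 0 L → f x = 0 := by
    have h1 : ∀ᵐ x ∂(mu L), f x = 0 := by
      filter_upwards [hu, (h0 ▸ Lp.coeFn_zero ℂ 2 (mu L) : (q.1 : ℝ → ℂ) =ᵐ[mu L] 0)]
        with x hx hx'
      rw [← hx, hx']
      rfl
    exact (ae_restrict_iff' measurableSet_Ioo).1 h1
  have hg0 : ∀ᵐ x ∂(volume : Measure ℝ), x ∈ Set.Ioo 0 L → g x = 0 := by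
    have key : ∀ k : ℕ, ∀ᵐ x ∂(volume : Measure ℝ),
        x ∈ Set.Ioo (L / (k + 3)) (L - L / (k + 3)) → 0 < L → g x = 0 := by
      intro k
      by_cases hL : 0 < L
      swap
      · exact Filter.Eventually.of_forall fun x _ h => absurd h hL
      have hk : (0 : ℝ) < k + 3 := by positivity
      have hlt : L / (k + 3) ≤ L / 3 := by
        apply div_le_div_of_nonneg_left hL.le (by norm_num)
        linarith [(Nat.cast_nonneg k : (0 : ℝ) ≤ k)]
      have hpos : 0 < L / (k + 3) := by positivity
      have ha : L / (k + 3) ∈ Set.Ioo 0 L := ⟨hpos, by linarith⟩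
      have hb : L - L / (k + 3) ∈ Set.Ioo 0 L := ⟨by linarith, by linarith⟩
      filter_upwards [(h _ ha _ hb).1.ae_hasDerivAt_integral] with x hx hxI _
      have hxI' : x ∈ Set.uIcc (L / (k + 3)) (L - L / (k + 3)) := by
        rw [Set.uIcc_of_le (by linarith)]
        exact ⟨hxI.1.le, hxI.2.le⟩
      have hx0 : x ∈ Set.Ioo 0 L := ⟨hpos.trans hxI.1, hxI.2.trans hb.2⟩
      have hd := hx hxI' _ hxI'
      have hd' : HasDerivAt f (g x) x := by
        have : f =ᶠ[nhds x] fun y => f x + ∫ t in x..y, g t := by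
          filter_upwards [isOpen_Ioo.mem_nhds hx0] with y hy
          rw [← (h x hx0 y hy).2]
          ring
        exact (hd.const_add (f x)).congr_of_eventuallyEq this
      have hfreq : ∃ᶠ y in nhdsWithin x {x}ᶜ, f y = 0 := by
        rw [Filter.frequently_iff]
        intro U hU
        have hvol : volume (U ∩ Set.Ioo 0 L) ≠ 0 := by
          obtain ⟨O, hO, hxO, hOU⟩ := mem_nhdsWithin.1 hU
          have hne : (O ∩ Set.Ioo 0 L).Nonempty := ⟨x, hxO, hx0⟩
          have := (hO.inter isOpen_Ioo).measure_pos volume hne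
          intro hz
          have hle : volume (O ∩ Set.Ioo 0 L) ≤ volume (U ∩ Set.Ioo 0 L) + volume {x} := by
            refine (measure_mono ?_).trans (measure_union_le _ _)
            intro y hy
            by_cases hyx : y = x
            · exact Or.inr hyx
            · exact Or.inl ⟨hOU ⟨hy.1, hyx⟩, hy.2⟩
          rw [hz, Real.volume_singleton, add_zero] at hle
          exact absurd this (not_lt.2 hle)
        by_contra hcon
        push Not at hcon
        refine hvol (measure_mono_null ?_ hf0)
        intro y hy hy'
        exact hcon y hy.1 (hy' hy.2)
      have hcont : f x = 0 := by
        have : ContinuousAt f x := hd'.continuousAt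
        by_contra hne
        have hev : ∀ᶠ y in nhdsWithin x {x}ᶜ, f y ≠ 0 :=
          (this.eventually_ne hne).filter_mono nhdsWithin_le_nhds
        obtain ⟨y, hy, hy'⟩ := (hfreq.and_eventually hev).exists
        exact hy' hy
      by_contra hne
      have hev := hd'.eventually_ne (c := 0) hne
      obtain ⟨y, hy, hy'⟩ := (hfreq.and_eventually hev).exists
      exact hy' hy
    filter_upwards [ae_all_iff.2 key] with x hx hxI
    have hL : 0 < L := hxI.1.trans hxI.2
    obtain ⟨k, hk⟩ := exists_nat_gt (max (L / x) (L / (L - x)))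
    have hk3 : (0 : ℝ) < k + 3 := by positivity
    refine hx k ⟨?_, ?_⟩ hL
    · rw [div_lt_iff₀ hk3]
      have := (div_lt_iff₀ hxI.1).1 ((le_max_left _ _).trans_lt hk)
      nlinarith [hxI.1]
    · have hpos : 0 < L - x := sub_pos.2 hxI.2
      have h1 := (div_lt_iff₀ hpos).1 ((le_max_right _ _).trans_lt hk)
      have h2 : L / (k + 3) < L - x := by
        rw [div_lt_iff₀ hk3]
        nlinarith
      linarith
  apply Lp.ext
  have hf0' : ∀ᵐ x ∂(mu L), f x = 0 := (ae_restrict_iff' measurableSet_Ioo).2 hf0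
  have hg0' : ∀ᵐ x ∂(mu L), g x = 0 := (ae_restrict_iff' measurableSet_Ioo).2 hg0
  filter_upwards [hv, hf0', hg0', Lp.coeFn_zero ℂ 2 (mu L)] with x h1 h2 h3 h4
  rw [h1, h2, h3, h4]
  simp

/-- The operator `A_m = ħ d/dx + W_m` in `L²([0, L])`, on the domain of all `u` in `L²` that are
absolutely continuous in `(0, L)` and satisfy `ħ u' + W_m u ∈ L²`. -/
noncomputable def Params.opA (p : Params) (m : ℕ) : Hilb p.L →ₗ.[ℂ] Hilb p.L :=
  (graphA p.L p.hbar (p.superpot m)).toLinearPMap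

/-- The product `S T` of two partially defined operators, on its natural domain
`{u ∈ dom T | T u ∈ dom S}`. -/
noncomputable def opMul {L : ℝ} (S T : Hilb L →ₗ.[ℂ] Hilb L) : Hilb L →ₗ.[ℂ] Hilb L :=
  S.comp (T.domRestrict ((S.domain.comap T.toFun).map T.domain.subtype)) (by
    rintro ⟨x, hx⟩
    obtain ⟨⟨y, hy, hyx⟩, hT⟩ := hx
    have hval : T.domRestrict ((S.domain.comap T.toFun).map T.domain.subtype)
        ⟨x, ⟨⟨y, hy, hyx⟩, hT⟩⟩ = T y :=
      LinearPMap.domRestrict_apply hyx.symm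
    rw [hval]
    exact hy)

/-- The product `T₁ T₂ ⋯ T_r` of a list of partially defined operators, on its natural domain. -/
noncomputable def opProd {L : ℝ} : List (Hilb L →ₗ.[ℂ] Hilb L) → (Hilb L →ₗ.[ℂ] Hilb L)
  | [] => LinearMap.id.toPMap ⊤
  | T :: l => opMul T (opProd l)

/-- `Λ_{m,n} = A_n A_{n-1} ⋯ A_{m+1}`. -/
noncomputable def Params.opLambda (p : Params) (m n : ℕ) : Hilb p.L →ₗ.[ℂ] Hilb p.L :=
  opProd ((List.Ico (m + 1) (n + 1)).reverse.map p.opA)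

/-- `Θ_{n,m} = A_{n+1}† A_{n+2}† ⋯ A_m†`, where `†` is the Hilbert space adjoint. -/
noncomputable def Params.opTheta (p : Params) (n m : ℕ) : Hilb p.L →ₗ.[ℂ] Hilb p.L :=
  opProd ((List.Ico (n + 1) (m + 1)).map fun k => (p.opA k).adjoint)

/-- The function `φ` is square integrable on `(0, L)`, lies in the domain of the operator `X`, and
its mean value `⟨X⟩_φ = ∫_0^L conj(φ) (X φ) dx` is `c`. -/
def HasMean {L : ℝ} (X : Hilb L →ₗ.[ℂ] Hilb L) (φ : ℝ → ℂ) (c : ℂ) : Prop :=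
  ∃ (hφ : MemLp φ 2 (mu L)) (hd : hφ.toLp φ ∈ X.domain), ⟪hφ.toLp φ, X ⟨hφ.toLp φ, hd⟩⟫_ℂ = c

/-! ### The constants -/

/-- The constant `𝓜(n, m)`, the nonnegative square root of
`∏_{k ≤ m} (n+m-k+1) (n+m+2ν+k+3) (1 + β² / ((k+ν+1) (n+m+ν+2))²)`. -/
noncomputable def Params.constM (p : Params) (n m : ℕ) : ℝ :=
  Real.sqrt (∏ k ∈ Finset.range (m + 1),
    ((n : ℝ) + m - k + 1) * (n + m + 2 * p.nu + k + 3) *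
      (1 + p.beta ^ 2 / ((k + p.nu + 1) * (n + m + p.nu + 2)) ^ 2))

/-- The constant
`𝓝(n, m) = ∏_{k ≤ m} (2n-k+1) (2n+2ν+k+3) (1 + β² / ((k+ν+1) (2n+ν+2))²)`. -/
noncomputable def Params.constN (p : Params) (n m : ℕ) : ℝ :=
  ∏ k ∈ Finset.range (m + 1),
    (2 * (n : ℝ) - k + 1) * (2 * n + 2 * p.nu + k + 3) *
      (1 + p.beta ^ 2 / ((k + p.nu + 1) * (2 * n + p.nu + 2)) ^ 2)

end PoschlTeller

/-
With `θ = πx/L`, every `A_{m-1} ⋯ A_0 φ_j` is a multiple of a function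
`sin^S θ exp (-βθ/S) Q (cot θ)` with `S = j + ν + 1` and `Q` a polynomial, and `A_m` and its formal
adjoint `A_m⁺` act on such functions through `Q`. The Jacobi equation says that `φ_j` is an
eigenfunction of `A_0⁺ A_0`, and shape invariance, `A_{m+1}⁺ A_{m+1} = A_m A_m⁺ + const`, carries
this to every level: `A_m⁺ A_m u_m = 2M (E_j - E_m) u_m` for `u_{m+1} = A_m u_m`. Hence the vectors
`u_m` are eigenvectors of the four products of operators, with products of energy gaps as
eigenvalues, and the mean values are these eigenvalues.

The eigenvalue equation forces each `A_m` to lower the degree of `Q`, so that `u_{m+1}` vanishes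
linearly at the endpoints. Therefore `u_{m+1}` lies in the domain of the Hilbert space adjoint
`A_m†`: for `f` in the domain of `A_m`, a nonzero boundary value of `f̄ u_{m+1}` would make `|f|`
dominate a multiple of `1/x`, which is not integrable.
-/

namespace PoschlTeller

/-! ### Ladder operators on polynomials -/

section Ladder

open Polynomial

variable {K : Type*} [Field K]

/-- The superpotential `s cot θ - β / s`, as a polynomial in `cot θ`. -/
noncomputable def superpotPoly (β s : K) : K[X] := C s * X - C (β / s)

/-- The action of `d/dθ` on the functions `sin^S θ exp (-β θ / S) Q (cot θ)`, in terms of the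
polynomial `Q`. -/
noncomputable def derivPoly (β S : K) : K[X] →ₗ[K] K[X] :=
  LinearMap.mulLeft K (superpotPoly β S) - LinearMap.mulLeft K (1 + X ^ 2) ∘ₗ derivative

/-- The action of `d/dθ - (s cot θ - β / s)` on the functions
`sin^S θ exp (-β θ / S) Q (cot θ)`, in terms of the polynomial `Q`. -/
noncomputable def lowerPoly (β S s : K) : K[X] →ₗ[K] K[X] :=
  derivPoly β S - LinearMap.mulLeft K (superpotPoly β s)

/-- The action of the formal adjoint `-d/dθ - (s cot θ - β / s)` on the functions
`sin^S θ exp (-β θ / S) Q (cot θ)`, in terms of the polynomial `Q`. -/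
noncomputable def raisePoly (β S s : K) : K[X] →ₗ[K] K[X] :=
  -derivPoly β S - LinearMap.mulLeft K (superpotPoly β s)

/-- The difference of the dimensionless energies `S² - β² / S²` and `s² - β² / s²`. -/
def energyGap (β S s : K) : K :=
  (S ^ 2 - (β / S) ^ 2) - (s ^ 2 - (β / s) ^ 2)

theorem derivPoly_apply (β S : K) (Q : K[X]) :
    derivPoly β S Q = superpotPoly β S * Q - (1 + X ^ 2) * derivative Q := rfl

theorem lowerPoly_apply (β S s : K) (Q : K[X]) :
    lowerPoly β S s Q = derivPoly β S Q - superpotPoly β s * Q := rfl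

theorem raisePoly_apply (β S s : K) (Q : K[X]) :
    raisePoly β S s Q = -derivPoly β S Q - superpotPoly β s * Q := rfl

theorem derivPoly_mul (β S : K) (P Q : K[X]) :
    derivPoly β S (P * Q) = P * derivPoly β S Q - (1 + X ^ 2) * derivative P * Q := by
  simp only [derivPoly_apply, derivative_mul]
  ring

theorem derivative_superpotPoly (β s : K) : derivative (superpotPoly β s) = C s := by
  simp only [superpotPoly, derivative_sub, derivative_C_mul, derivative_X, derivative_C, mul_one,
    sub_zero]

theorem raisePoly_lowerPoly (β S s : K) (Q : K[X]) :
    raisePoly β S s (lowerPoly β S s Q) =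
      (superpotPoly β s ^ 2 - C s * (1 + X ^ 2)) * Q - derivPoly β S (derivPoly β S Q) := by
  rw [raisePoly_apply, lowerPoly_apply, map_sub, derivPoly_mul, derivative_superpotPoly]
  ring

theorem lowerPoly_raisePoly (β S s : K) (Q : K[X]) :
    lowerPoly β S s (raisePoly β S s Q) =
      (superpotPoly β s ^ 2 + C s * (1 + X ^ 2)) * Q - derivPoly β S (derivPoly β S Q) := by
  rw [raisePoly_apply, lowerPoly_apply, map_sub, map_neg, derivPoly_mul, derivative_superpotPoly]
  ring

theorem superpotPoly_sq {s : K} (β : K) (hs : s ≠ 0) :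
    superpotPoly β s ^ 2 = C (s ^ 2) * X ^ 2 - C (2 * β) * X + C ((β / s) ^ 2) := by
  have h : C (2 * β) = (2 * (C s * C (β / s)) : K[X]) := by
    rw [← C_mul, mul_div_cancel₀ β hs, C_mul, map_ofNat]
  rw [h, superpotPoly, C_pow, C_pow]
  ring

theorem shape_invariance {s : K} (β S : K) (hs : s ≠ 0) (hs' : s + 1 ≠ 0) (Q : K[X]) :
    raisePoly β S (s + 1) (lowerPoly β S (s + 1) Q) =
      lowerPoly β S s (raisePoly β S s Q) +
        (energyGap β S (s + 1) - energyGap β S s) • Q := by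
  rw [raisePoly_lowerPoly, lowerPoly_raisePoly, superpotPoly_sq β hs, superpotPoly_sq β hs',
    smul_eq_C_mul]
  simp only [energyGap, C_sub, C_add, C_pow, C_1]
  ring

theorem raisePoly_lowerPoly_lowerPoly {β S s : K} (hs : s ≠ 0) (hs' : s + 1 ≠ 0) {Q : K[X]}
    (hQ : raisePoly β S s (lowerPoly β S s Q) = energyGap β S s • Q) :
    raisePoly β S (s + 1) (lowerPoly β S (s + 1) (lowerPoly β S s Q)) =
      energyGap β S (s + 1) • lowerPoly β S s Q := by
  rw [shape_invariance β S hs hs', hQ, map_smul, ← add_smul, add_sub_cancel]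

theorem coeff_X_mul_derivative {R : Type*} [CommSemiring R] (P : R[X]) (k : ℕ) :
    (X * derivative P).coeff k = k * P.coeff k := by
  cases k with
  | zero => rw [coeff_X_mul_zero, Nat.cast_zero, zero_mul]
  | succ k => rw [coeff_X_mul, coeff_derivative, Nat.cast_succ, mul_comm]

theorem coeff_derivPoly_succ (β S : K) (Q : K[X]) (k : ℕ) :
    (derivPoly β S Q).coeff (k + 1) =
      (S - k) * Q.coeff k - β / S * Q.coeff (k + 1) - (k + 2) * Q.coeff (k + 2) := by
  rw [derivPoly_apply, superpotPoly, sub_mul, mul_assoc, add_mul, one_mul, pow_two, mul_assoc,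
    coeff_sub, coeff_sub, coeff_add, coeff_C_mul, coeff_C_mul, coeff_X_mul, coeff_derivative,
    coeff_X_mul, coeff_X_mul_derivative]
  push_cast
  ring

theorem coeff_superpotPoly_mul_succ (β s : K) (Q : K[X]) (k : ℕ) :
    (superpotPoly β s * Q).coeff (k + 1) = s * Q.coeff k - β / s * Q.coeff (k + 1) := by
  rw [superpotPoly, sub_mul, mul_assoc, coeff_sub, coeff_C_mul, coeff_C_mul, coeff_X_mul]

/- Comparing top coefficients in `Q' := lowerPoly Q` only gives `degree Q' ≤ d`; the coefficient
of `X ^ (d + 1)` in the eigenvalue equation then kills that of `X ^ d` in `Q'`. -/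
theorem degree_lowerPoly_lt [CharZero K] {β s : K} (hs : s ≠ 0) {d : ℕ} {Q : K[X]}
    (hQ : raisePoly β (s + d) s (lowerPoly β (s + d) s Q) = energyGap β (s + d) s • Q)
    (hd : Q.degree < (d + 1 : ℕ)) : (lowerPoly β (s + d) s Q).degree < d := by
  rw [degree_lt_iff_coeff_zero] at hd ⊢
  have above : ∀ k, d ≤ k → (lowerPoly β (s + d) s Q).coeff (k + 1) = 0 := by
    intro k hk
    rw [lowerPoly_apply, coeff_sub, coeff_derivPoly_succ, coeff_superpotPoly_mul_succ,
      hd (k + 1) (by lia), hd (k + 2) (by lia)]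
    rcases hk.eq_or_lt with rfl | hlt
    · ring
    · rw [hd k hlt]; ring
  intro k hk
  rcases hk.eq_or_lt with rfl | hlt
  · have top := congrArg (fun P => P.coeff (d + 1)) hQ
    simp only [raisePoly_apply, coeff_sub, coeff_neg, coeff_derivPoly_succ,
      coeff_superpotPoly_mul_succ, coeff_smul, smul_eq_mul] at top
    rw [above d le_rfl, above (d + 1) (by lia), hd (d + 1) le_rfl] at top
    have h2s : 2 * s * (lowerPoly β (s + d) s Q).coeff d = 0 := by linear_combination -top
    exact (mul_eq_zero.1 h2s).resolve_left (mul_ne_zero two_ne_zero hs)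
  · obtain ⟨k, rfl⟩ := Nat.exists_eq_add_one_of_ne_zero (by lia : k ≠ 0)
    exact above k (by lia)

end Ladder

/-! ### Jacobi polynomials -/

section Jacobi

open Polynomial

/-- The coefficients of the Jacobi polynomial in powers of `(z - 1) / 2`. -/
noncomputable def jacobiCoeff (n : ℕ) (a b : ℂ) (k : ℕ) : ℂ :=
  (ascPochhammer ℂ k).eval (n + a + b + 1) * (ascPochhammer ℂ (n - k)).eval (a + k + 1) /
    ((k.factorial : ℂ) * ((n - k).factorial : ℂ))

/-- The Jacobi polynomial as a polynomial in `(z - 1) / 2`. -/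
noncomputable def jacobiPoly (n : ℕ) (a b : ℂ) : ℂ[X] :=
  ∑ k ∈ Finset.range (n + 1), C (jacobiCoeff n a b k) * X ^ k

/-- The polynomial in `cot θ` that equals `P_n^{(a, b)} (i cot θ)`. -/
noncomputable def cotPoly (n : ℕ) (a b : ℂ) : ℂ[X] :=
  (jacobiPoly n a b).comp (C (Complex.I / 2) * X - C (1 / 2))

theorem jacobi_eq_eval (n : ℕ) (a b z : ℂ) :
    jacobi n a b z = (jacobiPoly n a b).eval ((z - 1) / 2) := by
  simp only [jacobi, jacobiPoly, eval_finsetSum, eval_mul, eval_C, eval_pow, eval_X, jacobiCoeff]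

theorem coeff_jacobiPoly (n : ℕ) (a b : ℂ) (k : ℕ) :
    (jacobiPoly n a b).coeff k = if k ≤ n then jacobiCoeff n a b k else 0 := by
  simp [jacobiPoly, coeff_C_mul, coeff_X_pow]

theorem ascPochhammer_succ_eval_left {R : Type*} [CommSemiring R] (r : ℕ) (c : R) :
    (ascPochhammer R (r + 1)).eval c = c * (ascPochhammer R r).eval (c + 1) := by
  rw [ascPochhammer_succ_left, eval_mul, eval_X, eval_comp, eval_add, eval_X, eval_one]

theorem coeff_jacobiPoly_succ (n : ℕ) (a b : ℂ) (k : ℕ) :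
    (jacobiPoly n a b).coeff (k + 1) * (k + 1) * (k + a + 1) =
      (jacobiPoly n a b).coeff k * (n - k) * (k + n + a + b + 1) := by
  rw [coeff_jacobiPoly, coeff_jacobiPoly]
  rcases lt_trichotomy k n with h | rfl | h
  · rw [if_pos (by lia), if_pos h.le]
    obtain ⟨r, rfl⟩ := Nat.exists_eq_add_of_lt h
    have hshift : (ascPochhammer ℂ (r + 1)).eval (a + k + 1) =
        (a + k + 1) * (ascPochhammer ℂ r).eval (a + (k + 1 : ℕ) + 1) := by
      rw [ascPochhammer_succ_eval_left, Nat.cast_succ, add_assoc a (k : ℂ) 1]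
    rw [jacobiCoeff, jacobiCoeff, show k + r + 1 - (k + 1) = r by lia,
      show k + r + 1 - k = r + 1 by lia, hshift, ascPochhammer_succ_eval, Nat.factorial_succ,
      Nat.factorial_succ]
    have hk : (k.factorial : ℂ) ≠ 0 := Nat.cast_ne_zero.2 k.factorial_ne_zero
    have hr : (r.factorial : ℂ) ≠ 0 := Nat.cast_ne_zero.2 r.factorial_ne_zero
    have hk1 : (k : ℂ) + 1 ≠ 0 := Nat.cast_add_one_ne_zero k
    have hr1 : (r : ℂ) + 1 ≠ 0 := Nat.cast_add_one_ne_zero r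
    push_cast
    field_simp
    ring
  · rw [if_neg (by lia)]; ring
  · rw [if_neg (by lia), if_neg (by lia)]; ring

/- The hypergeometric equation, written with the Euler operator `E := X d/dX`, whose action on
coefficients is multiplication by the index: `(E + n + a + b + 1) (n - E) J = ...`. -/
theorem jacobiPoly_ode (n : ℕ) (a b : ℂ) :
    (X + X ^ 2) * derivative (derivative (jacobiPoly n a b)) +
      (C (a + 1) + C (a + b + 2) * X) * derivative (jacobiPoly n a b) =
        (n * (n + a + b + 1)) • jacobiPoly n a b := by
  set J := jacobiPoly n a b
  have euler : (X + X ^ 2) * derivative (derivative J) +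
      (C (a + 1) + C (a + b + 2) * X) * derivative J =
        X * derivative (derivative J) + C (a + 1) * derivative J +
          (X * derivative (X * derivative J) + C (a + b + 1) * (X * derivative J)) := by
    simp only [derivative_mul, derivative_X, C_add, C_1, map_ofNat]
    ring
  ext k
  rw [euler]
  simp only [coeff_add, coeff_C_mul, coeff_smul, smul_eq_mul, coeff_X_mul_derivative,
    coeff_derivative]
  linear_combination coeff_jacobiPoly_succ n a b k

theorem eval_cotPoly (n : ℕ) (a b c : ℂ) :
    (cotPoly n a b).eval c = jacobi n a b (Complex.I * c) := by
  rw [jacobi_eq_eval, cotPoly, eval_comp, eval_sub, eval_mul, eval_C, eval_C, eval_X]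
  ring_nf

theorem degree_cotPoly_lt (n : ℕ) (a b : ℂ) : (cotPoly n a b).degree < (n + 1 : ℕ) := by
  have hJ : (jacobiPoly n a b).natDegree ≤ n :=
    natDegree_le_iff_coeff_eq_zero.2 fun k hk => by rw [coeff_jacobiPoly, if_neg (by lia)]
  have hlin : (C (Complex.I / 2) * X - C (1 / 2) : ℂ[X]).natDegree ≤ 1 := by compute_degree
  have hle : (cotPoly n a b).natDegree ≤ n :=
    natDegree_comp_le.trans ((Nat.mul_le_mul hJ hlin).trans_eq (mul_one n))
  exact degree_le_natDegree.trans_lt (Nat.cast_lt.2 (Nat.lt_succ_of_le hle))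

theorem cotPoly_ne_zero {n : ℕ} {a b : ℂ} (h : ∀ k < n, (n + a + b + 1 : ℂ) ≠ -k) :
    cotPoly n a b ≠ 0 := by
  have hlead : (jacobiPoly n a b).coeff n ≠ 0 := by
    rw [coeff_jacobiPoly, if_pos le_rfl, jacobiCoeff, Nat.sub_self, ascPochhammer_zero, eval_one,
      mul_one]
    refine div_ne_zero (fun h0 => ?_) (by simp [Nat.factorial_ne_zero])
    obtain ⟨k, hk, hk'⟩ := (ascPochhammer_eval_eq_zero_iff n _).1 h0
    exact h k hk (by rw [hk', neg_neg])
  have hlin : (C (Complex.I / 2) * X - C (1 / 2) : ℂ[X]).natDegree = 1 := by compute_degree!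
  rw [cotPoly, Ne, comp_eq_zero_iff]
  rintro (hJ | ⟨-, hC⟩)
  · exact hlead (by rw [hJ, coeff_zero])
  · rw [hC, natDegree_C] at hlin
    exact zero_ne_one hlin

theorem cotPoly_ode (n : ℕ) (a b : ℂ) :
    (1 + X ^ 2) * derivative (derivative (cotPoly n a b)) +
      (C (-Complex.I * (a - b)) + C (a + b + 2) * X) * derivative (cotPoly n a b) =
        (n * (n + a + b + 1)) • cotPoly n a b := by
  have h := congrArg (fun P => P.comp (C (Complex.I / 2) * X - C (1 / 2))) (jacobiPoly_ode n a b)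
  simp only [add_comp, mul_comp, X_comp, pow_comp, C_comp, smul_comp] at h
  have hI : (C Complex.I * C Complex.I : ℂ[X]) = -1 := by
    rw [← C_mul, Complex.I_mul_I, C_neg, C_1]
  have hI2 : (C (Complex.I / 2) : ℂ[X]) = C Complex.I * C (1 / 2) := by rw [← C_mul]; ring_nf
  have h2 : (2 * C (1 / 2) : ℂ[X]) = 1 := by
    rw [← C_1, ← map_ofNat C, ← C_mul]; norm_num
  simp only [cotPoly, derivative_comp, derivative_mul, derivative_sub, derivative_C, derivative_X,
    zero_mul, mul_one, zero_add, sub_zero]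
  rw [← h, hI2]
  simp only [C_add, C_mul, C_neg, C_sub, C_1, map_ofNat]
  set J' := (derivative (jacobiPoly n a b)).comp (C Complex.I * C (1 / 2) * X - C (1 / 2))
  set J'' := (derivative (derivative (jacobiPoly n a b))).comp
    (C Complex.I * C (1 / 2) * X - C (1 / 2))
  set i : ℂ[X] := C Complex.I
  set u : ℂ[X] := C (1 / 2)
  linear_combination (J'' * u ^ 2 - J' * u * (C a - C b)) * hI +
    (J'' * (i * u * X - u) + J' * (C a + 1)) * h2

theorem raisePoly_lowerPoly_cotPoly (n : ℕ) (β : ℂ) {s : ℂ} {a b : ℂ} (hs : s ≠ 0)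
    (hS : s + n ≠ 0) (ha : a = -(s + n) + Complex.I * (β / (s + n)))
    (hb : b = -(s + n) - Complex.I * (β / (s + n))) :
    raisePoly β (s + n) s (lowerPoly β (s + n) s (cotPoly n a b)) =
      energyGap β (s + n) s • cotPoly n a b := by
  have hode := cotPoly_ode n a b
  have hsub : -Complex.I * (a - b) = 2 * (β / (s + n)) := by
    rw [ha, hb]; linear_combination (-2 * (β / (s + n))) * Complex.I_sq
  have hsum : a + b = -2 * (s + n) := by rw [ha, hb]; ring
  have heig : (n : ℂ) * (n + a + b + 1) = -n * (2 * s + n - 1) := by linear_combination n * hsum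
  rw [hsub, hsum, heig] at hode
  rw [raisePoly_lowerPoly]
  have hW : superpotPoly β (s + n) = (C s + C (n : ℂ)) * X - C (β / (s + n)) := by
    rw [superpotPoly, C_add]
  have hsq := superpotPoly_sq β hs
  have hSq := superpotPoly_sq β hS
  simp only [smul_eq_C_mul, energyGap, derivPoly_apply, derivative_superpotPoly, derivative_mul,
    derivative_sub, derivative_add, derivative_one, derivative_X_pow, C_sub, C_add, C_pow, C_1,
    C_mul, C_neg, Nat.cast_ofNat, map_ofNat] at hode hsq hSq ⊢
  linear_combination (-(1 + X ^ 2)) * hode + cotPoly n a b * (hsq - hSq) +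
    2 * (1 + X ^ 2) * derivative (cotPoly n a b) * hW

end Jacobi

/-! ### Functions of the form `sin^S exp Q(cot)` -/

section Profile

open Set Filter Polynomial

variable (p : Params)

/-- The shifted quantum number `j + ν + 1`. -/
noncomputable def Params.idx (j : ℕ) : ℝ := j + p.nu + 1

/-- The momentum scale `ħ π / L`. -/
noncomputable def Params.scale : ℝ := p.hbar * Real.pi / p.L

/-- The function `cot (π x / L)`. -/
noncomputable def Params.cot (x : ℝ) : ℝ := Real.cot (Real.pi * x / p.L)

/-- The function `sin^S (π x / L) exp (-β π x / (L S))`. -/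
noncomputable def Params.envelope (S x : ℝ) : ℝ :=
  Real.sin (Real.pi * x / p.L) ^ S * Real.exp (-(p.beta * Real.pi * x / (p.L * S)))

/-- The function `sin^S (π x / L) exp (-β π x / (L S)) Q (cot (π x / L))`. -/
noncomputable def Params.profile (S : ℝ) (Q : ℂ[X]) (x : ℝ) : ℂ :=
  (p.envelope S x : ℂ) * Q.eval (p.cot x : ℂ)

/-- The superpotential in closed form, `-(ħ π / L) (s cot (π x / L) - β / s)`. -/
noncomputable def Params.cotPotential (s x : ℝ) : ℝ :=
  -p.scale * (s * p.cot x - p.beta / s)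

variable {p} {S r s x : ℝ}

theorem Params.sin_pos (hx : x ∈ Ioo 0 p.L) : 0 < Real.sin (Real.pi * x / p.L) := by
  have hL : 0 < p.L := hx.1.trans hx.2
  refine Real.sin_pos_of_pos_of_lt_pi (div_pos (mul_pos Real.pi_pos hx.1) hL) ?_
  rw [div_lt_iff₀ hL]
  exact mul_lt_mul_of_pos_left hx.2 Real.pi_pos

theorem Params.envelope_pos (S : ℝ) (hx : x ∈ Ioo 0 p.L) : 0 < p.envelope S x :=
  mul_pos (Real.rpow_pos_of_pos (p.sin_pos hx) _) (Real.exp_pos _)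

theorem Params.hasDerivAt_angle (p : Params) (x : ℝ) :
    HasDerivAt (fun x => Real.pi * x / p.L) (Real.pi / p.L) x := by
  simpa only [mul_one] using ((hasDerivAt_id' x).const_mul Real.pi).div_const p.L

theorem Params.hasDerivAt_cot (hx : x ∈ Ioo 0 p.L) :
    HasDerivAt p.cot (-(Real.pi / p.L) * (1 + p.cot x ^ 2)) x := by
  have hsin := (p.sin_pos hx).ne'
  have hcot : p.cot = fun y => Real.cos (Real.pi * y / p.L) / Real.sin (Real.pi * y / p.L) :=
    funext fun y => Real.cot_eq_cos_div_sin _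
  rw [hcot]
  refine ((p.hasDerivAt_angle x).cos.div (p.hasDerivAt_angle x).sin hsin).congr_deriv ?_
  field_simp
  ring

theorem Params.hasDerivAt_envelope (S : ℝ) (hx : x ∈ Ioo 0 p.L) :
    HasDerivAt (p.envelope S)
      (Real.pi / p.L * (S * p.cot x - p.beta / S) * p.envelope S x) x := by
  have hsin := (p.sin_pos hx).ne'
  have hpow := (p.hasDerivAt_angle x).sin.rpow_const (p := S) (Or.inl hsin)
  have hexp : HasDerivAt (fun x => Real.exp (-(p.beta * Real.pi * x / (p.L * S)))) _ x :=
    (((hasDerivAt_id' x).const_mul (p.beta * Real.pi)).div_const (p.L * S)).fun_neg.exp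
  refine (hpow.mul hexp).congr_deriv ?_
  rw [Params.envelope, Params.cot, Real.cot_eq_cos_div_sin, Real.rpow_sub_one hsin]
  ring

theorem Params.hasDerivAt_profile (S : ℝ) (Q : ℂ[X]) (hx : x ∈ Ioo 0 p.L) :
    HasDerivAt (p.profile S Q)
      ((Real.pi / p.L : ℝ) * p.profile S (derivPoly (p.beta : ℂ) (S : ℂ) Q) x) x := by
  have henv := (p.hasDerivAt_envelope S hx).ofReal_comp
  have hQ := (Q.hasDerivAt (p.cot x : ℂ)).comp x (p.hasDerivAt_cot hx).ofReal_comp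
  refine (henv.mul hQ).congr_deriv ?_
  simp only [Params.profile, derivPoly_apply, superpotPoly, eval_mul, eval_sub, eval_C, eval_X,
    eval_add, eval_one, eval_pow, Function.comp_apply]
  push_cast
  ring

theorem Params.continuousOn_profile (S : ℝ) (Q : ℂ[X]) :
    ContinuousOn (p.profile S Q) (Ioo 0 p.L) :=
  fun _ hx => (p.hasDerivAt_profile S Q hx).continuousAt.continuousWithinAt

theorem Params.profile_lowerPoly (p : Params) (S s x : ℝ) (Q : ℂ[X]) :
    (p.hbar : ℂ) * ((Real.pi / p.L : ℝ) * p.profile S (derivPoly (p.beta : ℂ) (S : ℂ) Q) x) +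
      (p.cotPotential s x : ℂ) * p.profile S Q x =
        (p.scale : ℂ) * p.profile S (lowerPoly (p.beta : ℂ) S s Q) x := by
  simp only [Params.profile, lowerPoly_apply, superpotPoly, Params.cotPotential, Params.scale,
    eval_mul, eval_sub, eval_C, eval_X]
  push_cast
  ring

theorem Params.profile_raisePoly (p : Params) (S s x : ℝ) (Q : ℂ[X]) :
    -(p.hbar : ℂ) * ((Real.pi / p.L : ℝ) * p.profile S (derivPoly (p.beta : ℂ) (S : ℂ) Q) x) +
      (p.cotPotential s x : ℂ) * p.profile S Q x =
        (p.scale : ℂ) * p.profile S (raisePoly (p.beta : ℂ) S s Q) x := by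
  simp only [Params.profile, raisePoly_apply, superpotPoly, Params.cotPotential, Params.scale,
    eval_mul, eval_sub, eval_neg, eval_C, eval_X]
  push_cast
  ring

theorem Params.profile_smul (p : Params) (S x : ℝ) (c : ℂ) (Q : ℂ[X]) :
    p.profile S (c • Q) x = c * p.profile S Q x := by
  rw [Params.profile, Params.profile, eval_smul, smul_eq_mul, mul_left_comm]

theorem Params.envelope_le (S : ℝ) (hx : x ∈ Ioo 0 p.L) :
    p.envelope S x ≤
      Real.exp |p.beta * Real.pi / S| * Real.sin (Real.pi * x / p.L) ^ S := by
  have hxL : x / p.L ∈ Icc 0 1 :=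
    ⟨div_nonneg hx.1.le (hx.1.trans hx.2).le, div_le_one_of_le₀ hx.2.le (hx.1.trans hx.2).le⟩
  have hexp : -(p.beta * Real.pi * x / (p.L * S)) ≤ |p.beta * Real.pi / S| := by
    calc -(p.beta * Real.pi * x / (p.L * S)) = -(p.beta * Real.pi / S) * (x / p.L) := by ring
      _ ≤ |p.beta * Real.pi / S| * (x / p.L) :=
          mul_le_mul_of_nonneg_right (neg_le_abs _) hxL.1
      _ ≤ |p.beta * Real.pi / S| := mul_le_of_le_one_right (abs_nonneg _) hxL.2
  rw [Params.envelope, mul_comm]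
  exact mul_le_mul_of_nonneg_right (Real.exp_le_exp.2 hexp)
    (Real.rpow_nonneg (p.sin_pos hx).le _)

theorem Params.envelope_mul_abs_cot_pow_le {k : ℕ} (hk : k + r ≤ S) (hx : x ∈ Ioo 0 p.L) :
    p.envelope S x * |p.cot x| ^ k ≤
      Real.exp |p.beta * Real.pi / S| * Real.sin (Real.pi * x / p.L) ^ r := by
  set t := Real.sin (Real.pi * x / p.L)
  have hpos : 0 < t := p.sin_pos hx
  have hcot : |p.cot x| ≤ t⁻¹ := by
    rw [Params.cot, Real.cot_eq_cos_div_sin, abs_div, abs_of_pos hpos, div_eq_mul_inv]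
    exact mul_le_of_le_one_left (inv_nonneg.2 hpos.le) (Real.abs_cos_le_one _)
  calc p.envelope S x * |p.cot x| ^ k
      ≤ Real.exp |p.beta * Real.pi / S| * t ^ S * t⁻¹ ^ k :=
        mul_le_mul (p.envelope_le S hx) (pow_le_pow_left₀ (abs_nonneg _) hcot k)
          (by positivity) (by positivity)
    _ = Real.exp |p.beta * Real.pi / S| * t ^ (S - k) := by
        rw [Real.rpow_sub_natCast hpos.ne', inv_pow, mul_assoc, ← div_eq_mul_inv]
    _ ≤ Real.exp |p.beta * Real.pi / S| * t ^ r :=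
        mul_le_mul_of_nonneg_left
          (Real.rpow_le_rpow_of_exponent_ge hpos (Real.sin_le_one _) (by linarith))
          (Real.exp_pos _).le

theorem Params.exists_norm_profile_le {Q : ℂ[X]} (hQ : ∀ k ∈ Q.support, k + r ≤ S) :
    ∃ K, ∀ x ∈ Ioo 0 p.L, ‖p.profile S Q x‖ ≤ K * Real.sin (Real.pi * x / p.L) ^ r := by
  refine ⟨∑ k ∈ Q.support, ‖Q.coeff k‖ * Real.exp |p.beta * Real.pi / S|, fun x hx => ?_⟩
  rw [Params.profile, eval_eq_sum, Polynomial.sum, Finset.mul_sum, Finset.sum_mul]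
  refine norm_sum_le_of_le _ fun k hk => ?_
  rw [norm_mul, norm_mul, norm_pow, Complex.norm_real, Complex.norm_real,
    Real.norm_of_nonneg (p.envelope_pos S hx).le, Real.norm_eq_abs, mul_left_comm, mul_assoc]
  exact mul_le_mul_of_nonneg_left (p.envelope_mul_abs_cot_pow_le (hQ k hk) hx) (norm_nonneg _)

instance isFiniteMeasure_mu (L : ℝ) : IsFiniteMeasure (mu L) :=
  inferInstanceAs (IsFiniteMeasure (volume.restrict (Ioo 0 L)))

theorem memLp_of_continuousOn_of_bound {L K : ℝ} {f : ℝ → ℂ} (hf : ContinuousOn f (Ioo 0 L))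
    (hb : ∀ x ∈ Ioo 0 L, ‖f x‖ ≤ K) : MemLp f 2 (mu L) :=
  MemLp.of_bound (hf.aestronglyMeasurable measurableSet_Ioo) K
    ((ae_restrict_iff' measurableSet_Ioo).2 (Eventually.of_forall hb))

theorem Params.memLp_profile {Q : ℂ[X]} (hQ : ∀ k ∈ Q.support, (k : ℝ) ≤ S) :
    MemLp (p.profile S Q) 2 (mu p.L) := by
  obtain ⟨K, hK⟩ := p.exists_norm_profile_le (r := 0) (by simpa only [add_zero] using hQ)
  simp only [Real.rpow_zero, mul_one] at hK
  exact memLp_of_continuousOn_of_bound (p.continuousOn_profile S Q) hK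

/-- The functions on `(0, L)` that are bounded by a multiple of the distance to the boundary, so
that their products with the functions in the domains of the operators `A_m` leave no
boundary terms. -/
def VanishesLinearly (L : ℝ) (G : ℝ → ℂ) : Prop :=
  ∃ K, ∀ x ∈ Ioo 0 L, ‖G x‖ ≤ K * min x (L - x)

theorem Params.sin_le (hx : x ∈ Ioo 0 p.L) :
    Real.sin (Real.pi * x / p.L) ≤ Real.pi / p.L * min x (p.L - x) := by
  have hL : 0 < p.L := hx.1.trans hx.2
  have hpi : 0 < Real.pi / p.L := div_pos Real.pi_pos hL
  rw [mul_min_of_nonneg _ _ hpi.le]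
  refine le_min ?_ ?_
  · rw [mul_div_right_comm]
    exact Real.sin_le (mul_pos hpi hx.1).le
  · rw [← Real.sin_pi_sub, show Real.pi - Real.pi * x / p.L = Real.pi / p.L * (p.L - x) by
      field_simp]
    exact Real.sin_le (mul_pos hpi (sub_pos.2 hx.2)).le

theorem Params.vanishesLinearly_profile {Q : ℂ[X]} (hQ : ∀ k ∈ Q.support, (k : ℝ) + 1 ≤ S) :
    VanishesLinearly p.L (p.profile S Q) := by
  obtain ⟨K, hK⟩ := p.exists_norm_profile_le hQ
  refine ⟨|K| * (Real.pi / p.L), fun x hx => (hK x hx).trans ?_⟩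
  rw [Real.rpow_one, mul_assoc]
  exact (mul_le_mul_of_nonneg_right (le_abs_self K) (p.sin_pos hx).le).trans
    (mul_le_mul_of_nonneg_left (p.sin_le hx) (abs_nonneg K))

theorem Params.exists_cot_eq (hL : 0 < p.L) (y : ℝ) : ∃ x ∈ Ioo 0 p.L, p.cot x = y := by
  have hpi := Real.pi_pos
  have hlow := Real.neg_pi_div_two_lt_arctan y
  have hup := Real.arctan_lt_pi_div_two y
  refine ⟨p.L / Real.pi * (Real.pi / 2 - Real.arctan y), ⟨?_, ?_⟩, ?_⟩
  · exact mul_pos (div_pos hL hpi) (by linarith)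
  · calc _ < p.L / Real.pi * Real.pi :=
          mul_lt_mul_of_pos_left (by linarith) (div_pos hL hpi)
      _ = p.L := div_mul_cancel₀ _ hpi.ne'
  · have hangle : Real.pi * (p.L / Real.pi * (Real.pi / 2 - Real.arctan y)) / p.L =
        Real.pi / 2 - Real.arctan y := by field_simp
    rw [Params.cot, hangle, Real.cot_eq_cos_div_sin, Real.cos_pi_div_two_sub,
      Real.sin_pi_div_two_sub, ← Real.tan_eq_sin_div_cos, Real.tan_arctan]

theorem Params.eq_zero_of_profile_ae_eq_zero (hL : 0 < p.L) {Q : ℂ[X]}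
    (h : p.profile S Q =ᵐ[mu p.L] 0) : Q = 0 := by
  have hzero : EqOn (p.profile S Q) 0 (Ioo 0 p.L) :=
    Measure.eqOn_open_of_ae_eq h isOpen_Ioo (p.continuousOn_profile S Q) continuousOn_const
  refine Polynomial.eq_zero_of_infinite_isRoot Q
    ((infinite_range_of_injective Complex.ofReal_injective).mono ?_)
  rintro _ ⟨y, rfl⟩
  obtain ⟨x, hx, rfl⟩ := p.exists_cot_eq hL y
  exact (mul_eq_zero.1 (hzero hx)).resolve_left
    (Complex.ofReal_ne_zero.2 (p.envelope_pos S hx).ne')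

end Profile

/-! ### Integration by parts -/

section AbsolutelyContinuous

open Set

variable {E : Type*} [NormedAddCommGroup E] [NormedSpace ℝ E] {a b : ℝ}

theorem absolutelyContinuousOnInterval_of_dist_le {X Y : Type*} [PseudoMetricSpace X]
    [PseudoMetricSpace Y] {f : ℝ → X} {F : ℝ → Y} (hF : AbsolutelyContinuousOnInterval F a b)
    (h : ∀ x ∈ uIcc a b, ∀ y ∈ uIcc a b, dist (f x) (f y) ≤ dist (F x) (F y)) :
    AbsolutelyContinuousOnInterval f a b := by
  rw [absolutelyContinuousOnInterval_iff] at hF ⊢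
  intro ε hε
  obtain ⟨δ, hδ, H⟩ := hF ε hε
  exact ⟨δ, hδ, fun I hI hlen => (Finset.sum_le_sum fun i hi =>
    h _ (hI.1 i hi).1 _ (hI.1 i hi).2).trans_lt (H I hI hlen)⟩

theorem absolutelyContinuousOnInterval_primitive {g : ℝ → E}
    (hg : IntervalIntegrable g volume a b) :
    AbsolutelyContinuousOnInterval (fun x => ∫ t in a..x, g t) a b := by
  have hint : ∀ x ∈ uIcc a b, IntervalIntegrable g volume a x := fun x hx =>
    hg.mono_set (uIcc_subset_uIcc_left hx)
  refine absolutelyContinuousOnInterval_of_dist_le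
    (hg.norm.absolutelyContinuousOnInterval_intervalIntegral left_mem_uIcc) fun x hx y hy => ?_
  rw [dist_eq_norm, dist_eq_norm, intervalIntegral.integral_interval_sub_left (hint x hx)
    (hint y hy), intervalIntegral.integral_interval_sub_left (hint x hx).norm (hint y hy).norm]
  exact intervalIntegral.norm_integral_le_abs_integral_norm

theorem integral_eq_sub_of_ae_hasDerivAt [CompleteSpace E] {f g : ℝ → E}
    (hf : AbsolutelyContinuousOnInterval f a b) (hg : IntervalIntegrable g volume a b)
    (hd : ∀ᵐ x, x ∈ uIcc a b → HasDerivAt f (g x) x) : ∫ x in a..b, g x = f b - f a := by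
  obtain ⟨C, hC⟩ := (hf.sub (absolutelyContinuousOnInterval_primitive hg)
    ).const_of_ae_hasDerivAt_zero (by
      filter_upwards [hd, hg.ae_hasDerivAt_integral] with x hfx hgx hx
      simpa only [sub_self] using (hfx hx).sub (hgx hx a left_mem_uIcc))
  have hab := (hC a left_mem_uIcc).trans (hC b right_mem_uIcc).symm
  simp only [Pi.sub_apply, intervalIntegral.integral_same, sub_zero] at hab
  rw [hab, sub_sub_cancel]

end AbsolutelyContinuous

section IntegrationByParts

open Set Filter Topology

variable {L a b : ℝ} {f g G G' : ℝ → ℂ}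

theorem hasACDeriv_of_hasDerivAt (hG : ∀ x ∈ Ioo 0 L, HasDerivAt G (G' x) x)
    (hG' : ContinuousOn G' (Ioo 0 L)) : HasACDeriv L G G' := by
  intro a ha b hb
  have hsub : uIcc a b ⊆ Ioo 0 L := ordConnected_Ioo.uIcc_subset ha hb
  have hint : IntervalIntegrable G' volume a b := (hG'.mono hsub).intervalIntegrable
  exact ⟨hint, (intervalIntegral.integral_eq_sub_of_hasDerivAt
    (fun x hx => hG x (hsub hx)) hint).symm⟩

theorem HasACDeriv.conj (h : HasACDeriv L f g) :
    HasACDeriv L (fun x => starRingEnd ℂ (f x)) (fun x => starRingEnd ℂ (g x)) := by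
  intro a ha b hb
  obtain ⟨hint, hsub⟩ := h a ha b hb
  refine ⟨intervalIntegrable_iff.2
    (Complex.conjLIE.integrable_comp_iff.2 (intervalIntegrable_iff.1 hint)), ?_⟩
  rw [← map_sub, hsub, intervalIntegral.intervalIntegral_conj]

theorem HasACDeriv.absolutelyContinuousOnInterval (h : HasACDeriv L f g) (ha : a ∈ Ioo 0 L)
    (hb : b ∈ Ioo 0 L) : AbsolutelyContinuousOnInterval f a b := by
  refine absolutelyContinuousOnInterval_of_dist_le
    (absolutelyContinuousOnInterval_primitive (h a ha b hb).1) fun x hx y hy => ?_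
  have hsub : uIcc a b ⊆ Ioo 0 L := ordConnected_Ioo.uIcc_subset ha hb
  rw [← (h a ha x (hsub hx)).2, ← (h a ha y (hsub hy)).2, dist_sub_right]

theorem HasACDeriv.ae_hasDerivAt (h : HasACDeriv L f g) (ha : a ∈ Ioo 0 L) (hb : b ∈ Ioo 0 L) :
    ∀ᵐ x, x ∈ uIcc a b → HasDerivAt f (g x) x := by
  filter_upwards [(h a ha b hb).1.ae_hasDerivAt_integral] with x hx hxab
  refine ((hx hxab a left_mem_uIcc).const_add (f a)).congr_of_eventuallyEq ?_
  filter_upwards [isOpen_Ioo.mem_nhds (ordConnected_Ioo.uIcc_subset ha hb hxab)] with y hy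
  rw [← (h a ha y hy).2, add_sub_cancel]

theorem HasACDeriv.mul (hf : HasACDeriv L f g) (hG : HasACDeriv L G G') :
    HasACDeriv L (fun x => f x * G x) (fun x => g x * G x + f x * G' x) := by
  intro a ha b hb
  have hfac := hf.absolutelyContinuousOnInterval ha hb
  have hGac := hG.absolutelyContinuousOnInterval ha hb
  have hint : IntervalIntegrable (fun x => g x * G x + f x * G' x) volume a b :=
    ((hf a ha b hb).1.mul_continuousOn hGac.continuousOn).add
      ((hG a ha b hb).1.continuousOn_mul hfac.continuousOn)
  refine ⟨hint, (integral_eq_sub_of_ae_hasDerivAt (hfac.smul hGac) hint ?_).symm⟩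
  filter_upwards [hf.ae_hasDerivAt ha hb, hG.ae_hasDerivAt ha hb] with x hfx hGx hx
  exact (hfx hx).mul (hGx hx)

theorem HasACDeriv.reflect (h : HasACDeriv L f g) :
    HasACDeriv L (fun x => f (L - x)) (fun x => -g (L - x)) := by
  have hmem : ∀ x ∈ Ioo 0 L, L - x ∈ Ioo 0 L := fun x hx =>
    ⟨sub_pos.2 hx.2, sub_lt_self L hx.1⟩
  intro a ha b hb
  obtain ⟨hint, hsub⟩ := h (L - a) (hmem a ha) (L - b) (hmem b hb)
  refine ⟨?_, ?_⟩
  · have hrefl := (hint.comp_sub_left L).neg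
    rwa [sub_sub_cancel, sub_sub_cancel] at hrefl
  · rw [hsub, intervalIntegral.integral_neg, intervalIntegral.integral_comp_sub_left,
      ← intervalIntegral.integral_symm]

theorem eq_zero_of_tendsto_of_norm_le_mul {E : Type*} [NormedAddCommGroup E] {Φ : ℝ → E} {l : E}
    {k : ℝ → ℝ} (hL : 0 < L) (hΦ : Tendsto Φ (𝓝[>] 0) (𝓝 l))
    (hb : ∀ x ∈ Ioo 0 L, ‖Φ x‖ ≤ k x * x) (hk : IntegrableOn k (Ioo 0 L)) : l = 0 := by
  by_contra hl
  have hl' : 0 < ‖l‖ := norm_pos_iff.2 hl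
  have hlarge : ∀ᶠ x in 𝓝[>] (0 : ℝ), ‖l‖ / 2 < ‖Φ x‖ :=
    hΦ.norm.eventually (lt_mem_nhds (half_lt_self hl'))
  obtain ⟨δ, hδ, hsub⟩ :=
    (mem_nhdsGT_iff_exists_Ioo_subset' hL).1 (hlarge.and (Ioo_mem_nhdsGT hL))
  have hδ0 : 0 < δ := hδ
  have hinv : IntegrableOn (fun x : ℝ => x⁻¹) (Ioo 0 δ) := by
    refine Integrable.mono' ((hk.mono_set fun x hx => (hsub hx).2).const_mul (2 / ‖l‖))
      measurable_inv.aestronglyMeasurable ?_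
    refine (ae_restrict_iff' measurableSet_Ioo).2 (Eventually.of_forall fun x hx => ?_)
    have hlt : ‖l‖ / 2 < k x * x := (hsub hx).1.trans_le (hb x (hsub hx).2)
    rw [norm_inv, Real.norm_of_nonneg hx.1.le, inv_le_iff_one_le_mul₀ hx.1, div_mul_eq_mul_div,
      div_mul_eq_mul_div, le_div_iff₀ hl']
    linarith
  have hinv' : IntervalIntegrable (fun x : ℝ => x⁻¹) volume 0 δ :=
    (intervalIntegrable_iff_integrableOn_Ioo_of_le hδ0.le).2 hinv
  exact (intervalIntegrable_inv_iff.1 hinv').elim hδ0.ne fun h => h left_mem_uIcc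

theorem HasACDeriv.integral_eq_of_norm_le {k : ℝ → ℝ} {x : ℝ} (h : HasACDeriv L f g)
    (hg : IntegrableOn g (Ioo 0 L)) (hk : IntegrableOn k (Ioo 0 L))
    (hb : ∀ y ∈ Ioo 0 L, ‖f y‖ ≤ k y * y) (hx : x ∈ Ioo 0 L) : ∫ t in (0 : ℝ)..x, g t = f x := by
  have hint : IntegrableOn g (uIcc 0 x) := by
    rw [uIcc_of_le hx.1.le, integrableOn_Icc_iff_integrableOn_Ioo]
    exact hg.mono_set (Ioo_subset_Ioo_right hx.2.le)
  have hprim : Tendsto (fun y => ∫ t in y..x, g t) (𝓝[>] 0) (𝓝 (∫ t in (0 : ℝ)..x, g t)) := by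
    rw [← nhdsWithin_Ioo_eq_nhdsGT hx.1]
    exact (intervalIntegral.continuousOn_primitive_interval_left hint 0 left_mem_uIcc).mono
      (Ioo_subset_Icc_self.trans Icc_subset_uIcc)
  have hlim : Tendsto f (𝓝[>] 0) (𝓝 (f x - ∫ t in (0 : ℝ)..x, g t)) := by
    refine (hprim.const_sub (f x)).congr' ?_
    filter_upwards [Ioo_mem_nhdsGT (hx.1.trans hx.2)] with y hy
    rw [← (h y hy x hx).2, sub_sub_cancel]
  exact (sub_eq_zero.1 (eq_zero_of_tendsto_of_norm_le_mul (hx.1.trans hx.2) hlim hb hk)).symm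

theorem HasACDeriv.integral_eq_zero {k : ℝ → ℝ} (hL : 0 < L) (h : HasACDeriv L f g)
    (hg : IntegrableOn g (Ioo 0 L)) (hk : IntegrableOn k (Ioo 0 L))
    (hb : ∀ x ∈ Ioo 0 L, ‖f x‖ ≤ k x * min x (L - x)) : ∫ x in Ioo 0 L, g x = 0 := by
  have hk0 : ∀ x ∈ Ioo 0 L, 0 ≤ k x := fun x hx =>
    nonneg_of_mul_nonneg_left ((norm_nonneg _).trans (hb x hx)) (lt_min hx.1 (sub_pos.2 hx.2))
  have hhalf : L / 2 ∈ Ioo 0 L := ⟨half_pos hL, half_lt_self hL⟩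
  have hmem : ∀ x ∈ Ioo 0 L, L - x ∈ Ioo 0 L := fun x hx =>
    ⟨sub_pos.2 hx.2, sub_lt_self L hx.1⟩
  have hreflect : ∀ {E : Type} [NormedAddCommGroup E] {φ : ℝ → E},
      IntegrableOn φ (Ioo 0 L) → IntegrableOn (fun x => φ (L - x)) (Ioo 0 L) := by
    intro E _ φ hφ
    rw [← intervalIntegrable_iff_integrableOn_Ioo_of_le hL.le] at hφ ⊢
    simpa only [sub_zero, sub_self] using (hφ.comp_sub_left L).symm
  have hleft : ∫ t in (0 : ℝ)..L / 2, g t = f (L / 2) :=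
    h.integral_eq_of_norm_le hg hk (fun x hx => (hb x hx).trans
      (mul_le_mul_of_nonneg_left (min_le_left _ _) (hk0 x hx))) hhalf
  have hright := h.reflect.integral_eq_of_norm_le (hreflect hg).neg (hreflect hk)
    (fun x hx => (hb _ (hmem x hx)).trans
      (mul_le_mul_of_nonneg_left (by rw [sub_sub_cancel]; exact min_le_right _ _)
        (hk0 _ (hmem x hx)))) hhalf
  rw [intervalIntegral.integral_neg, intervalIntegral.integral_comp_sub_left, sub_zero,
    sub_half] at hright
  have hint : ∀ {a b}, 0 ≤ a → a ≤ b → b ≤ L → IntervalIntegrable g volume a b :=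
    fun ha hab hb => (intervalIntegrable_iff_integrableOn_Ioo_of_le hab).2
      (hg.mono_set (Ioo_subset_Ioo ha hb))
  rw [← integral_Ioc_eq_integral_Ioo, ← intervalIntegral.integral_of_le hL.le,
    ← intervalIntegral.integral_add_adjacent_intervals
      (hint le_rfl hhalf.1.le hhalf.2.le) (hint hhalf.1.le hhalf.2.le le_rfl), hleft, ← hright,
    neg_add_cancel]

theorem inner_eq_of_mem_graphA {hbar : ℝ} {W : ℝ → ℂ} (hL : 0 < L) (hbar0 : hbar ≠ 0)
    (hW : ∀ x ∈ Ioo 0 L, starRingEnd ℂ (W x) = W x) (hG : HasACDeriv L G G')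
    (hG0 : VanishesLinearly L G) {u v y z : Hilb L} (huv : (u, v) ∈ graphA L hbar W)
    (hy : y =ᵐ[mu L] G) (hz : z =ᵐ[mu L] fun x => -(hbar : ℂ) * G' x + W x * G x) :
    ⟪v, y⟫_ℂ = ⟪u, z⟫_ℂ := by
  obtain ⟨f, g, hfg, hu : u =ᵐ[mu L] f, hv : v =ᵐ[mu L] _⟩ := huv
  set w : ℝ → ℂ := fun x => starRingEnd ℂ (g x) * G x + starRingEnd ℂ (f x) * G' x with hw
  have hvy := L2.integrable_inner (𝕜 := ℂ) v y
  have huz := L2.integrable_inner (𝕜 := ℂ) u z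
  have hae : (fun x => ⟪v x, y x⟫_ℂ - ⟪u x, z x⟫_ℂ) =ᵐ[mu L] fun x => (hbar : ℂ) * w x := by
    filter_upwards [hu, hv, hy, hz, ae_restrict_mem measurableSet_Ioo] with x h1 h2 h3 h4 h5
    rw [h1, h2, h3, h4, RCLike.inner_apply, RCLike.inner_apply, map_add, map_mul, map_mul, hW x h5,
      Complex.conj_ofReal, hw]
    ring
  have hwi : IntegrableOn w (Ioo 0 L) :=
    (integrable_const_mul_iff (Ne.isUnit (Complex.ofReal_ne_zero.2 hbar0)) w).1
      ((hvy.sub huz).congr hae)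
  have hfi : Integrable f (mu L) := ((Lp.memLp u).integrable one_le_two).congr hu
  obtain ⟨K, hK⟩ := hG0
  have hzero : ∫ x, w x ∂(mu L) = 0 := by
    refine (hfg.conj.mul hG).integral_eq_zero hL hwi (hfi.norm.mul_const |K|) fun x hx => ?_
    have hmin : 0 ≤ min x (L - x) := le_min hx.1.le (sub_pos.2 hx.2).le
    rw [norm_mul, RCLike.norm_conj, mul_assoc]
    exact mul_le_mul_of_nonneg_left ((hK x hx).trans
      (mul_le_mul_of_nonneg_right (le_abs_self K) hmin)) (norm_nonneg _)
  rw [← sub_eq_zero, L2.inner_def, L2.inner_def, ← integral_sub hvy huz, integral_congr_ae hae,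
    integral_const_mul, hzero, mul_zero]

end IntegrationByParts

/-! ### Products and adjoints of partially defined operators -/

section Products

variable {L : ℝ}

theorem mem_graph_opMul {S T : Hilb L →ₗ.[ℂ] Hilb L} {u w : Hilb L} :
    (u, w) ∈ (opMul S T).graph ↔ ∃ v, (u, v) ∈ T.graph ∧ (v, w) ∈ S.graph := by
  constructor
  · intro h
    obtain ⟨⟨x, hx⟩, rfl, rfl⟩ := (LinearPMap.mem_graph_iff _).1 h
    obtain ⟨⟨y, hy, hyx⟩, hT⟩ := id hx
    have hval : T.domRestrict ((S.domain.comap T.toFun).map T.domain.subtype)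
        ⟨x, ⟨⟨y, hy, hyx⟩, hT⟩⟩ = T y := LinearPMap.domRestrict_apply hyx.symm
    exact ⟨T y, (LinearPMap.mem_graph_iff _).2 ⟨y, hyx, rfl⟩,
      (LinearPMap.mem_graph_iff _).2 ⟨⟨T y, hy⟩, rfl, congrArg S (Subtype.ext hval.symm)⟩⟩
  · rintro ⟨v, huv, hvw⟩
    obtain ⟨x, rfl, rfl⟩ := (LinearPMap.mem_graph_iff _).1 huv
    obtain ⟨y, hy, rfl⟩ := (LinearPMap.mem_graph_iff _).1 hvw
    have hyx : (y : Hilb L) = T x := hy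
    have hx : (x : Hilb L) ∈ (opMul S T).domain := ⟨⟨x, (hyx ▸ y.2 : T x ∈ S.domain), rfl⟩, x.2⟩
    have hval : T.domRestrict ((S.domain.comap T.toFun).map T.domain.subtype)
        ⟨x, hx⟩ = T x := LinearPMap.domRestrict_apply rfl
    exact (LinearPMap.mem_graph_iff _).2
      ⟨⟨x, hx⟩, rfl, congrArg S (Subtype.ext (hval.trans hyx.symm))⟩

theorem mem_graph_opProd_nil {u w : Hilb L} :
    (u, w) ∈ (opProd ([] : List (Hilb L →ₗ.[ℂ] Hilb L))).graph ↔ u = w := by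
  rw [LinearPMap.mem_graph_iff]
  constructor
  · rintro ⟨x, rfl, h⟩
    exact h
  · rintro rfl
    exact ⟨⟨u, trivial⟩, rfl, rfl⟩

theorem mem_graph_opProd_cons {T : Hilb L →ₗ.[ℂ] Hilb L} {l : List (Hilb L →ₗ.[ℂ] Hilb L)}
    {u w : Hilb L} :
    (u, w) ∈ (opProd (T :: l)).graph ↔ ∃ v, (u, v) ∈ (opProd l).graph ∧ (v, w) ∈ T.graph :=
  mem_graph_opMul

theorem mem_graph_opProd_concat {l : List (Hilb L →ₗ.[ℂ] Hilb L)} {T : Hilb L →ₗ.[ℂ] Hilb L}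
    {u w : Hilb L} :
    (u, w) ∈ (opProd (l ++ [T])).graph ↔ ∃ v, (u, v) ∈ T.graph ∧ (v, w) ∈ (opProd l).graph := by
  induction l generalizing w with
  | nil => simp only [List.nil_append, mem_graph_opProd_cons, mem_graph_opProd_nil, exists_eq_left',
      exists_eq_right]
  | cons S l ih =>
    simp only [List.cons_append, mem_graph_opProd_cons, ih]
    exact ⟨fun ⟨x, ⟨v, huv, hvx⟩, hxw⟩ => ⟨v, huv, x, hvx, hxw⟩,
      fun ⟨v, huv, x, hvx, hxw⟩ => ⟨x, ⟨v, huv, hvx⟩, hxw⟩⟩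

theorem smul_mem_graph_opMul {S T : Hilb L →ₗ.[ℂ] Hilb L} {u v : Hilb L} {c d : ℂ}
    (hT : (u, c • v) ∈ T.graph) (hS : (v, d • u) ∈ S.graph) :
    (u, (c * d) • u) ∈ (opMul S T).graph :=
  mem_graph_opMul.2 ⟨_, hT, mul_smul c d u ▸ S.graph.smul_mem c hS⟩

section Chains

variable {T : ℕ → Hilb L →ₗ.[ℂ] Hilb L} {e : ℕ → Hilb L} {r : ℕ → ℂ}

theorem mem_graph_opProd_reverse_Ico (h : ∀ k, (e k, r k • e (k + 1)) ∈ (T k).graph) {a b : ℕ}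
    (hab : a ≤ b) :
    (e a, (∏ k ∈ Finset.Ico a b, r k) • e b) ∈
      (opProd ((List.Ico a b).reverse.map T)).graph := by
  induction b, hab using Nat.le_induction with
  | base => rw [List.Ico.self_empty]; exact mem_graph_opProd_nil.2 (by simp)
  | succ b hab ih =>
    rw [List.Ico.succ_top hab, List.reverse_append, List.reverse_singleton, List.singleton_append,
      List.map_cons, mem_graph_opProd_cons]
    refine ⟨_, ih, ?_⟩
    rw [Finset.prod_Ico_succ_top hab, mul_smul]
    exact (T b).graph.smul_mem _ (h b)

theorem mem_graph_opProd_Ico (h : ∀ k, (e (k + 1), r k • e k) ∈ (T k).graph) {a b : ℕ}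
    (hab : a ≤ b) :
    (e b, (∏ k ∈ Finset.Ico a b, r k) • e a) ∈ (opProd ((List.Ico a b).map T)).graph := by
  induction hab using Nat.decreasingInduction with
  | self => rw [List.Ico.self_empty]; exact mem_graph_opProd_nil.2 (by simp)
  | of_succ a hab ih =>
    rw [List.Ico.eq_cons hab, List.map_cons, mem_graph_opProd_cons]
    refine ⟨_, ih, ?_⟩
    rw [Finset.prod_eq_prod_Ico_succ_bot hab, mul_comm, mul_smul]
    exact (T a).graph.smul_mem _ (h a)

end Chains

theorem subset_domain_opProd {D : Set (Hilb L)} (l : List (Hilb L →ₗ.[ℂ] Hilb L))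
    (h : ∀ S ∈ l, ∀ u ∈ D, ∃ v ∈ D, (u, v) ∈ S.graph) :
    D ⊆ (opProd l).domain := by
  suffices hD : ∀ u ∈ D, ∃ v ∈ D, (u, v) ∈ (opProd l).graph by
    intro u hu
    obtain ⟨v, -, huv⟩ := hD u hu
    exact LinearPMap.mem_domain_of_mem_graph huv
  induction l with
  | nil => exact fun u hu => ⟨u, hu, mem_graph_opProd_nil.2 rfl⟩
  | cons S l ih =>
    intro u hu
    obtain ⟨v, hv, huv⟩ := ih (fun S hS => h S (List.mem_cons_of_mem _ hS)) u hu
    obtain ⟨w, hw, hvw⟩ := h S List.mem_cons_self v hv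
    exact ⟨w, hw, mem_graph_opProd_cons.2 ⟨v, huv, hvw⟩⟩

theorem mem_graph_adjoint {T : Hilb L →ₗ.[ℂ] Hilb L} (hT : Dense (T.domain : Set (Hilb L)))
    {y z : Hilb L} :
    (y, z) ∈ T.adjoint.graph ↔ ∀ u v, (u, v) ∈ T.graph → ⟪v, y⟫_ℂ = ⟪u, z⟫_ℂ := by
  rw [LinearPMap.adjoint_graph_eq_graph_adjoint hT, Submodule.mem_adjoint_iff]
  simp only [sub_eq_zero]

theorem isFormalAdjoint_iff {T S : Hilb L →ₗ.[ℂ] Hilb L} :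
    T.IsFormalAdjoint S ↔
      ∀ u v, (u, v) ∈ T.graph → ∀ y z, (y, z) ∈ S.graph → ⟪v, y⟫_ℂ = ⟪u, z⟫_ℂ := by
  simp only [LinearPMap.mem_graph_iff]
  constructor
  · rintro h u v ⟨x, rfl, rfl⟩ y z ⟨x', rfl, rfl⟩
    exact h x x'
  · exact fun h x y => h x _ ⟨x, rfl, rfl⟩ y _ ⟨y, rfl, rfl⟩

theorem isFormalAdjoint_opProd {ι : Type*} {T T' : ι → Hilb L →ₗ.[ℂ] Hilb L}
    (h : ∀ k, (T k).IsFormalAdjoint (T' k)) (l : List ι) :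
    (opProd (l.map T)).IsFormalAdjoint (opProd (l.reverse.map T')) := by
  rw [isFormalAdjoint_iff]
  induction l with
  | nil =>
    intro u v huv y z hyz
    rw [mem_graph_opProd_nil.1 huv, mem_graph_opProd_nil.1 hyz]
  | cons k l ih =>
    intro u w huw y z hyz
    rw [List.map_cons, mem_graph_opProd_cons] at huw
    rw [List.reverse_cons, List.map_append, List.map_singleton, mem_graph_opProd_concat] at hyz
    obtain ⟨v, huv, hvw⟩ := huw
    obtain ⟨x, hyx, hxz⟩ := hyz
    rw [isFormalAdjoint_iff.1 (h k) v w hvw y x hyx, ih u v huv x z hxz]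

theorem hasMean_of_smul_mem_graph {X : Hilb L →ₗ.[ℂ] Hilb L} {φ : ℝ → ℂ} {u : Hilb L} {c : ℂ}
    (hφ : u =ᵐ[mu L] φ) (hu : ‖u‖ = 1) (h : (u, c • u) ∈ X.graph) : HasMean X φ c := by
  have hmem : MemLp φ 2 (mu L) := (Lp.memLp u).ae_eq hφ
  obtain rfl : hmem.toLp φ = u := Lp.ext (hmem.coeFn_toLp.trans hφ.symm)
  have hd := LinearPMap.mem_domain_of_mem_graph h
  refine ⟨hmem, hd, ?_⟩
  rw [← (LinearPMap.image_iff hd).2 h, inner_smul_right, inner_self_eq_norm_sq_to_K, hu]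
  simp

end Products

theorem Params.mem_graph_opA (p : Params) (m : ℕ) (q : Hilb p.L × Hilb p.L) :
    q ∈ (p.opA m).graph ↔ q ∈ graphA p.L p.hbar (p.superpot m) := by
  rw [Params.opA, Submodule.toLinearPMap_graph_eq]
  exact graphA_snd_eq_zero _ _ _

/-! ### The hierarchy in terms of polynomials -/

section Hierarchy

open Polynomial

variable {p : Params}

theorem Params.idx_succ (p : Params) (m : ℕ) : p.idx (m + 1) = p.idx m + 1 := by
  rw [Params.idx, Params.idx, Nat.cast_succ]
  ring

theorem Params.idx_add (p : Params) (m d : ℕ) : p.idx (m + d) = p.idx m + d := by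
  rw [Params.idx, Params.idx, Nat.cast_add]
  ring

theorem Params.idx_pos (hnu : -1 < p.nu) (m : ℕ) : 0 < p.idx m := by
  rw [Params.idx]
  linarith [(m.cast_nonneg : (0 : ℝ) ≤ m)]

theorem Params.idx_lt_idx (p : Params) {m j : ℕ} (h : m < j) : p.idx m < p.idx j := by
  simpa only [Params.idx, add_lt_add_iff_right, Nat.cast_lt] using h

/-- The dimensionless energy difference `2 M (E_j - E_m) / (ħ π / L)²`. -/
noncomputable def Params.gap (p : Params) (m j : ℕ) : ℝ :=
  energyGap p.beta (p.idx j) (p.idx m)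

theorem Params.ofReal_gap (p : Params) (m j : ℕ) :
    (p.gap m j : ℂ) = energyGap (p.beta : ℂ) (p.idx j) (p.idx m) := by
  simp only [Params.gap, energyGap, Complex.ofReal_sub, Complex.ofReal_pow, Complex.ofReal_div]

theorem Params.gap_eq_mul (hnu : -1 < p.nu) (m j : ℕ) :
    p.gap m j = (p.idx j - p.idx m) * (p.idx j + p.idx m) *
      (1 + p.beta ^ 2 / (p.idx m * p.idx j) ^ 2) := by
  have hm := (p.idx_pos hnu m).ne'
  have hj := (p.idx_pos hnu j).ne'
  rw [Params.gap, energyGap]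
  field_simp
  ring

theorem Params.gap_pos (hnu : -1 < p.nu) {m j : ℕ} (h : m < j) : 0 < p.gap m j := by
  rw [p.gap_eq_mul hnu]
  have hm := p.idx_pos hnu m
  have hj := p.idx_pos hnu j
  have hmj := sub_pos.2 (p.idx_lt_idx h)
  positivity

/-- The dimensionless form `∏_{k < m} 2 M (E_j - E_k) / (ħ π / L)²` of the square of the
normalization constant of `A_{m-1} ⋯ A_0 φ_j`. -/
noncomputable def Params.gapProd (p : Params) (m j : ℕ) : ℝ :=
  ∏ k ∈ Finset.range m, p.gap k j

theorem Params.gapProd_pos (hnu : -1 < p.nu) {m j : ℕ} (h : m ≤ j) : 0 < p.gapProd m j :=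
  Finset.prod_pos fun _ hk => p.gap_pos hnu ((Finset.mem_range.1 hk).trans_le h)

theorem Params.energy_sub (hmass : p.mass ≠ 0) (m j : ℕ) :
    2 * p.mass * (p.energy j - p.energy m) = p.scale ^ 2 * p.gap m j := by
  have heps : 2 * p.mass * p.eps = p.scale ^ 2 := by
    rw [Params.eps, Params.scale]
    field_simp
  simp only [Params.energy, Params.gap, energyGap, Params.idx, div_pow, ← heps]
  ring

theorem Params.hierNorm_eq (hmass : p.mass ≠ 0) (m j : ℕ) :
    p.hierNorm m j = √((p.scale ^ m) ^ 2 * p.gapProd m j) := by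
  rw [Params.hierNorm, Params.gapProd, pow_right_comm]
  nth_rw 1 3 [← Finset.card_range m]
  simp only [Finset.pow_card_mul_prod, p.energy_sub hmass]

/-- The polynomial `Q` for which `A_{m-1} ⋯ A_0 φ_j` is, up to a constant factor,
`sin^S exp Q(cot)` with `S = j + ν + 1`. -/
noncomputable def Params.ladderPoly (p : Params) : ℕ → ℕ → ℂ[X]
  | 0, j => cotPoly j (p.a j) (starRingEnd ℂ (p.a j))
  | m + 1, j => lowerPoly (p.beta : ℂ) (p.idx j) (p.idx m) (p.ladderPoly m j)

theorem Params.rawEigenfun_eq (p : Params) (j : ℕ) :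
    p.rawEigenfun j = p.profile (p.idx j) (p.ladderPoly 0 j) := by
  funext x
  have hidx : p.nu + j + 1 = p.idx j := by rw [Params.idx]; ring
  rw [Params.rawEigenfun, Params.profile, Params.ladderPoly, eval_cotPoly, hidx]
  rfl

theorem Params.a_eq (p : Params) (j : ℕ) :
    p.a j = -(p.idx j : ℂ) + Complex.I * (p.beta / p.idx j) := by
  rw [Params.a, Params.idx, Complex.ofReal_div]

theorem Params.raisePoly_ladderPoly_succ (hnu : -1 < p.nu) (m j : ℕ) :
    raisePoly (p.beta : ℂ) (p.idx j) (p.idx m) (p.ladderPoly (m + 1) j) =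
      (p.gap m j : ℂ) • p.ladderPoly m j := by
  have hidx (i : ℕ) : (p.idx i : ℂ) ≠ 0 := Complex.ofReal_ne_zero.2 (p.idx_pos hnu i).ne'
  rw [p.ofReal_gap]
  induction m with
  | zero =>
    have hj : (p.idx j : ℂ) = p.idx 0 + j := by
      rw [← zero_add j, p.idx_add, zero_add]
      push_cast
      rfl
    have ha := p.a_eq j
    simp only [Params.ladderPoly]
    rw [hj] at ha ⊢
    refine raisePoly_lowerPoly_cotPoly j p.beta (hidx 0) (hj ▸ hidx j) ha ?_
    rw [ha, ← hj]
    simp only [map_add, map_neg, map_mul, Complex.conj_I, map_div₀, Complex.conj_ofReal]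
    ring
  | succ m ih =>
    have hm : (p.idx (m + 1) : ℂ) = p.idx m + 1 := by rw [p.idx_succ]; push_cast; rfl
    rw [Params.ladderPoly, Params.ladderPoly, hm]
    exact raisePoly_lowerPoly_lowerPoly (hidx m) (hm ▸ hidx (m + 1)) ih

theorem Params.degree_ladderPoly_lt (hnu : -1 < p.nu) (m j : ℕ) :
    (p.ladderPoly m j).degree < (j + 1 - m : ℕ) := by
  induction m with
  | zero => exact degree_cotPoly_lt _ _ _
  | succ m ih =>
    rcases le_or_gt m j with hmj | hjm
    · obtain ⟨d, rfl⟩ := Nat.exists_eq_add_of_le hmj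
      have hS : (p.idx (m + d) : ℂ) = p.idx m + d := by rw [p.idx_add]; push_cast; rfl
      have heig := p.raisePoly_ladderPoly_succ hnu m (m + d)
      rw [p.ofReal_gap] at heig
      rw [Params.ladderPoly] at heig ⊢
      rw [hS] at heig ⊢
      rw [show m + d + 1 - m = d + 1 by lia] at ih
      rw [show m + d + 1 - (m + 1) = d by lia]
      exact degree_lowerPoly_lt (Complex.ofReal_ne_zero.2 (p.idx_pos hnu m).ne') heig ih
    · rw [Nat.sub_eq_zero_of_le (by lia : j + 1 ≤ m), Nat.cast_zero, ← not_le,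
        zero_le_degree_iff, not_not] at ih
      rw [Params.ladderPoly, ih, map_zero, degree_zero]
      exact WithBot.bot_lt_coe _

theorem Params.add_idx_le_of_mem_support (hnu : -1 < p.nu) {m j k : ℕ}
    (hk : k ∈ (p.ladderPoly m j).support) : k + p.idx m ≤ p.idx j := by
  have hlt : k < j + 1 - m := by
    by_contra! hle
    exact mem_support_iff.1 hk
      (coeff_eq_zero_of_degree_lt ((p.degree_ladderPoly_lt hnu m j).trans_le (Nat.cast_le.2 hle)))
  obtain ⟨d, rfl⟩ := Nat.exists_eq_add_of_le (show m + k ≤ j by lia)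
  rw [p.idx_add, p.idx_add]
  linarith [(d.cast_nonneg : (0 : ℝ) ≤ d)]

theorem Params.ladderPoly_ne_zero (hnu : -1 < p.nu) {m j : ℕ} (h : m ≤ j) :
    p.ladderPoly m j ≠ 0 := by
  induction m with
  | zero =>
    refine cotPoly_ne_zero fun k hk h0 => ?_
    have hre := congrArg Complex.re h0
    simp only [Params.a, Complex.add_re, Complex.neg_re, Complex.ofReal_re, Complex.mul_re,
      Complex.I_re, Complex.I_im, Complex.ofReal_im, Complex.conj_re, Complex.natCast_re,
      Complex.one_re] at hre
    have hk' : (k : ℝ) + 1 ≤ j := by exact_mod_cast hk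
    linarith
  | succ m ih =>
    intro h0
    have heig := p.raisePoly_ladderPoly_succ hnu m j
    rw [h0, map_zero] at heig
    exact smul_ne_zero (Complex.ofReal_ne_zero.2 (p.gap_pos hnu h).ne') (ih (by lia)) heig.symm

end Hierarchy

/-! ### The vectors of the hierarchy in `L²` -/

section Vectors

open Set Polynomial

variable {p : Params}

theorem norm_toLp_eq_sqrt {α : Type*} [MeasurableSpace α] {μ : Measure α} {f : α → ℂ}
    (hf : MemLp f 2 μ) : ‖hf.toLp f‖ = √(∫ x, ‖f x‖ ^ 2 ∂μ) := by
  rw [Lp.norm_toLp, hf.eLpNorm_eq_integral_rpow_norm two_ne_zero ENNReal.ofNat_ne_top,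
    ENNReal.toReal_ofReal (by positivity), Real.sqrt_eq_rpow]
  norm_num

theorem Params.memLp_ladder (hnu : -1 < p.nu) (m j : ℕ) :
    MemLp (p.profile (p.idx j) (p.ladderPoly m j)) 2 (mu p.L) :=
  p.memLp_profile fun _ hk => (le_add_of_nonneg_right (p.idx_pos hnu m).le).trans
    (p.add_idx_le_of_mem_support hnu hk)

theorem Params.vanishesLinearly_ladder_succ (hnu : -1 < p.nu) (m j : ℕ) :
    VanishesLinearly p.L (p.profile (p.idx j) (p.ladderPoly (m + 1) j)) :=
  p.vanishesLinearly_profile fun _ hk => by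
    have hle := p.add_idx_le_of_mem_support hnu hk
    rw [p.idx_succ] at hle
    linarith [p.idx_pos hnu m]

/-- The vector of `L²([0, L])` that is represented by `sin^S exp Q(cot)` with `S = j + ν + 1` and
`Q = p.ladderPoly m j`: up to a constant factor, `A_{m-1} ⋯ A_0 φ_j`. -/
noncomputable def Params.ladderVec (p : Params) (hnu : -1 < p.nu) (m j : ℕ) : Hilb p.L :=
  (p.memLp_ladder hnu m j).toLp _

theorem Params.coeFn_ladderVec (hnu : -1 < p.nu) (m j : ℕ) :
    p.ladderVec hnu m j =ᵐ[mu p.L] p.profile (p.idx j) (p.ladderPoly m j) :=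
  MemLp.coeFn_toLp _

theorem Params.ladderVec_ne_zero (hL : 0 < p.L) (hnu : -1 < p.nu) {m j : ℕ} (h : m ≤ j) :
    p.ladderVec hnu m j ≠ 0 := fun h0 =>
  p.ladderPoly_ne_zero hnu h (p.eq_zero_of_profile_ae_eq_zero hL
    ((p.coeFn_ladderVec hnu m j).symm.trans ((Lp.eq_zero_iff_ae_eq_zero).1 h0)))

theorem Params.normConst_eq (hL : 0 < p.L) (hnu : -1 < p.nu) (j : ℕ) :
    p.normConst j = ‖p.ladderVec hnu 0 j‖⁻¹ := by
  rw [Params.normConst, Params.ladderVec, norm_toLp_eq_sqrt, p.rawEigenfun_eq,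
    intervalIntegral.integral_of_le hL.le, integral_Ioc_eq_integral_Ioo, mu]

theorem superpotOf_eq {hbar : ℝ} {f : ℝ → ℂ} {w : ℂ} {x : ℝ} (h : HasDerivAt f (w * f x) x)
    (h0 : f x ≠ 0) : superpotOf hbar f x = -hbar * w := by
  rw [superpotOf, h.deriv, ← mul_assoc, mul_div_cancel_right₀ _ h0]

/-- The conditions on the parameters under which the hierarchy is well defined: `ħ` and the mass
do not vanish, the interval is nonempty, and the ground states are square integrable functions
whose images under the operators `A_m` vanish at the boundary. -/
structure Params.IsAdmissible (p : Params) : Prop where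
  hbar_ne_zero : p.hbar ≠ 0
  mass_ne_zero : p.mass ≠ 0
  L_pos : 0 < p.L
  neg_one_lt_nu : -1 < p.nu

namespace Params.IsAdmissible

theorem scale_ne_zero (hp : p.IsAdmissible) : p.scale ≠ 0 :=
  div_ne_zero (mul_ne_zero hp.hbar_ne_zero Real.pi_ne_zero) hp.L_pos.ne'

theorem hierNorm_pos (hp : p.IsAdmissible) {m j : ℕ} (h : m ≤ j) : 0 < p.hierNorm m j := by
  rw [p.hierNorm_eq hp.mass_ne_zero]
  exact Real.sqrt_pos.2 (mul_pos (even_two.pow_pos (pow_ne_zero m hp.scale_ne_zero))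
    (p.gapProd_pos hp.neg_one_lt_nu h))

theorem normConst_ne_zero (hp : p.IsAdmissible) (j : ℕ) : p.normConst j ≠ 0 := by
  rw [p.normConst_eq hp.L_pos hp.neg_one_lt_nu]
  exact inv_ne_zero (norm_ne_zero_iff.2 (p.ladderVec_ne_zero hp.L_pos _ j.zero_le))

theorem superpot_eq_of_ladder_eq (hp : p.IsAdmissible) {m : ℕ}
    (h : EqOn (p.ladder m m) (fun x => (p.normConst m * p.scale ^ m : ℝ) *
      p.profile (p.idx m) (p.ladderPoly m m) x) (Ioo 0 p.L)) {x : ℝ} (hx : x ∈ Ioo 0 p.L) :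
    p.superpot m x = p.cotPotential (p.idx m) x := by
  have hnu := hp.neg_one_lt_nu
  obtain ⟨c, hc⟩ : ∃ c, p.ladderPoly m m = C c := by
    refine ⟨_, eq_C_of_degree_le_zero ?_⟩
    have hdeg := p.degree_ladderPoly_lt hnu m m
    rw [Nat.add_sub_cancel_left] at hdeg
    exact Order.lt_succ_iff.1 hdeg
  have hc0 : c ≠ 0 := fun h0 => p.ladderPoly_ne_zero hnu le_rfl (by rw [hc, h0, C_0])
  set κ : ℂ := (p.normConst m * p.scale ^ m : ℝ) * c / p.hierNorm m m with hκ
  have hκ0 : κ ≠ 0 := by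
    refine div_ne_zero (mul_ne_zero ?_ hc0) (Complex.ofReal_ne_zero.2 (hp.hierNorm_pos le_rfl).ne')
    exact Complex.ofReal_ne_zero.2
      (mul_ne_zero (hp.normConst_ne_zero m) (pow_ne_zero m hp.scale_ne_zero))
  have hground : EqOn (p.hierEigenfun m 0) (fun y => κ * p.envelope (p.idx m) y) (Ioo 0 p.L) := by
    intro y hy
    simp only [Params.hierEigenfun, zero_add, h hy, hc, Params.profile, eval_C, hκ]
    ring
  have hne : p.hierEigenfun m 0 x ≠ 0 := by
    rw [hground hx]
    exact mul_ne_zero hκ0 (Complex.ofReal_ne_zero.2 (p.envelope_pos _ hx).ne')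
  have hderiv : HasDerivAt (p.hierEigenfun m 0)
      ((Real.pi / p.L * (p.idx m * p.cot x - p.beta / p.idx m) : ℝ) * p.hierEigenfun m 0 x) x := by
    refine (((p.hasDerivAt_envelope (p.idx m) hx).ofReal_comp.const_mul κ).congr_deriv
      ?_).congr_of_eventuallyEq (hground.eventuallyEq_of_mem (isOpen_Ioo.mem_nhds hx))
    rw [hground hx, Complex.ofReal_mul]
    ring
  rw [Params.superpot, superpotOf_eq hderiv hne, Params.cotPotential, Params.scale]
  push_cast
  ring

theorem ladder_eq (hp : p.IsAdmissible) (m j : ℕ) :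
    EqOn (p.ladder m j) (fun x => (p.normConst j * p.scale ^ m : ℝ) *
      p.profile (p.idx j) (p.ladderPoly m j) x) (Ioo 0 p.L) := by
  induction m generalizing j with
  | zero =>
    intro x _
    simp only [Params.ladder, Params.eigenfun, p.rawEigenfun_eq, pow_zero, mul_one]
  | succ m ih =>
    intro x hx
    have hderiv := ((p.hasDerivAt_profile (p.idx j) (p.ladderPoly m j) hx).const_mul
      ((p.normConst j * p.scale ^ m : ℝ) : ℂ)).congr_of_eventuallyEq
        ((ih j).eventuallyEq_of_mem (isOpen_Ioo.mem_nhds hx))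
    have hlower := p.profile_lowerPoly (p.idx j) (p.idx m) x (p.ladderPoly m j)
    simp only [p.ladder_succ, applyA, hderiv.deriv, hp.superpot_eq_of_ladder_eq (ih m) hx, ih j hx,
      Params.ladderPoly, pow_succ]
    push_cast at hlower ⊢
    linear_combination ((p.normConst j : ℂ) * (p.scale : ℂ) ^ m) * hlower

theorem superpot_eq (hp : p.IsAdmissible) (m : ℕ) {x : ℝ} (hx : x ∈ Ioo 0 p.L) :
    p.superpot m x = p.cotPotential (p.idx m) x :=
  hp.superpot_eq_of_ladder_eq (hp.ladder_eq m m) hx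

end Params.IsAdmissible

end Vectors

/-! ### Test functions and density of domains -/

section TestFunctions

open Set Topology
open scoped ContDiff

/-- The smooth functions with compact support in `(0, L)`, a common invariant domain of the
operators `A_m` and of their adjoints. -/
structure IsTestFun (L : ℝ) (φ : ℝ → ℂ) : Prop where
  contDiff : ContDiff ℝ ∞ φ
  hasCompactSupport : HasCompactSupport φ
  tsupport_subset : tsupport φ ⊆ Ioo 0 L

variable {L : ℝ} {φ ψ : ℝ → ℂ}

theorem IsTestFun.add (hφ : IsTestFun L φ) (hψ : IsTestFun L ψ) : IsTestFun L (φ + ψ) :=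
  ⟨hφ.contDiff.add hψ.contDiff, hφ.hasCompactSupport.add hψ.hasCompactSupport,
    (tsupport_add φ ψ).trans (union_subset hφ.tsupport_subset hψ.tsupport_subset)⟩

theorem IsTestFun.mul_left (hφ : IsTestFun L φ) {W : ℝ → ℂ} (hW : ContDiffOn ℝ ∞ W (Ioo 0 L)) :
    IsTestFun L (W * φ) := by
  have hsub : tsupport (W * φ) ⊆ tsupport φ := tsupport_mul_subset_right
  refine ⟨contDiff_iff_contDiffAt.2 fun x => ?_, hφ.hasCompactSupport.mul_left,
    hsub.trans hφ.tsupport_subset⟩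
  by_cases hx : x ∈ tsupport φ
  · exact (hW.contDiffAt (isOpen_Ioo.mem_nhds (hφ.tsupport_subset hx))).mul hφ.contDiff.contDiffAt
  · have h0 : W * φ =ᶠ[𝓝 x] fun _ => 0 :=
      notMem_tsupport_iff_eventuallyEq.1 fun h => hx (hsub h)
    exact contDiffAt_const.congr_of_eventuallyEq h0

theorem IsTestFun.hasDerivAt (hφ : IsTestFun L φ) (x : ℝ) : HasDerivAt φ (deriv φ x) x :=
  (hφ.contDiff.differentiable (by simp) x).hasDerivAt

theorem IsTestFun.deriv (hφ : IsTestFun L φ) : IsTestFun L (deriv φ) :=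
  ⟨(contDiff_infty_iff_deriv.1 hφ.contDiff).2, hφ.hasCompactSupport.deriv,
    tsupport_deriv_subset.trans hφ.tsupport_subset⟩

theorem IsTestFun.hasACDeriv (hφ : IsTestFun L φ) : HasACDeriv L φ (_root_.deriv φ) :=
  hasACDeriv_of_hasDerivAt (fun x _ => hφ.hasDerivAt x) hφ.deriv.contDiff.continuous.continuousOn

theorem IsTestFun.memLp (hφ : IsTestFun L φ) : MemLp φ 2 (mu L) :=
  hφ.contDiff.continuous.memLp_of_hasCompactSupport hφ.hasCompactSupport

theorem IsTestFun.vanishesLinearly (hφ : IsTestFun L φ) : VanishesLinearly L φ := by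
  have hd {x : ℝ} (hx : x ∈ Ioo 0 L) : 0 < min x (L - x) := lt_min hx.1 (sub_pos.2 hx.2)
  have hcont : ContinuousOn (fun x => ‖φ x‖ / min x (L - x)) (tsupport φ) :=
    hφ.contDiff.continuous.norm.continuousOn.div (by fun_prop)
      fun x hx => (hd (hφ.tsupport_subset hx)).ne'
  obtain ⟨K, hK⟩ := hφ.hasCompactSupport.isCompact.exists_bound_of_continuousOn hcont
  refine ⟨|K|, fun x hx => ?_⟩
  by_cases hxs : x ∈ tsupport φ
  · exact (div_le_iff₀ (hd hx)).1 (((le_abs_self _).trans (hK x hxs)).trans (le_abs_self K))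
  · rw [image_eq_zero_of_notMem_tsupport hxs, norm_zero]
    exact mul_nonneg (abs_nonneg K) (hd hx).le

/-- The vectors of `L²([0, L])` that are represented by test functions. -/
def testVectors (L : ℝ) : Set (Hilb L) := {u | ∃ φ, IsTestFun L φ ∧ u =ᵐ[mu L] φ}

theorem IsTestFun.toLp_mem_testVectors (hφ : IsTestFun L φ) : hφ.memLp.toLp φ ∈ testVectors L :=
  ⟨φ, hφ, hφ.memLp.coeFn_toLp⟩

theorem dense_of_testVectors_subset {P : Submodule ℂ (Hilb L)} (h : testVectors L ⊆ P) :
    Dense (P : Set (Hilb L)) := by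
  rw [Submodule.dense_iff_topologicalClosure_eq_top, Submodule.topologicalClosure_eq_top_iff,
    Submodule.eq_bot_iff]
  intro v hv
  have hloc : LocallyIntegrableOn v (Ioo 0 L) volume :=
    IntegrableOn.locallyIntegrableOn ((Lp.memLp v).integrable one_le_two)
  have hzero : ∀ᵐ x, x ∈ Ioo 0 L → v x = 0 := by
    refine isOpen_Ioo.ae_eq_zero_of_integral_contDiff_smul_eq_zero hloc fun g hg hgc hgs => ?_
    have ht : IsTestFun L (fun x => (g x : ℂ)) :=
      ⟨Complex.ofRealCLM.contDiff.comp hg, hgc.comp_left Complex.ofReal_zero,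
        (tsupport_comp_subset Complex.ofReal_zero g).trans hgs⟩
    have horth := (Submodule.mem_orthogonal _ _).1 hv _ (h ht.toLp_mem_testVectors)
    rw [L2.inner_def] at horth
    rw [← setIntegral_eq_integral_of_forall_compl_eq_zero (s := Ioo 0 L), ← horth]
    · refine integral_congr_ae ?_
      filter_upwards [ht.memLp.coeFn_toLp] with x hx
      rw [hx, RCLike.inner_apply, Complex.conj_ofReal, Complex.real_smul, mul_comm]
    · intro x hx
      rw [image_eq_zero_of_notMem_tsupport fun h => hx (hgs h), zero_smul]
  exact (Lp.eq_zero_iff_ae_eq_zero).2 ((ae_restrict_iff' measurableSet_Ioo).2 hzero)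

end TestFunctions

section Domains

open Set
open scoped ContDiff

variable {p : Params}

theorem Params.contDiffOn_cotPotential (p : Params) (s : ℝ) :
    ContDiffOn ℝ ∞ (fun x => (p.cotPotential s x : ℂ)) (Ioo 0 p.L) := by
  have hcot : ContDiffOn ℝ ∞ p.cot (Ioo 0 p.L) := by
    have hangle : ContDiff ℝ ∞ fun x : ℝ => Real.pi * x / p.L := by fun_prop
    exact (hangle.cos.contDiffOn.div hangle.sin.contDiffOn
      fun x hx => (p.sin_pos hx).ne').congr fun x _ => Real.cot_eq_cos_div_sin _
  exact Complex.ofRealCLM.contDiff.comp_contDiffOn (contDiffOn_const.mul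
    ((contDiffOn_const.mul hcot).sub contDiffOn_const))

theorem IsTestFun.const_mul_deriv_add_cotPotential_mul {φ : ℝ → ℂ} (hφ : IsTestFun p.L φ) (s : ℝ)
    (c : ℂ) : IsTestFun p.L (fun x => c * _root_.deriv φ x + p.cotPotential s x * φ x) :=
  (hφ.deriv.mul_left contDiffOn_const).add (hφ.mul_left (p.contDiffOn_cotPotential s))

namespace Params.IsAdmissible

theorem mem_graph_opA_of_hasACDeriv (hp : p.IsAdmissible) (m : ℕ) {G G' : ℝ → ℂ}
    {u v : Hilb p.L} (hG : HasACDeriv p.L G G') (hu : u =ᵐ[mu p.L] G)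
    (hv : v =ᵐ[mu p.L] fun x => (p.hbar : ℂ) * G' x + p.cotPotential (p.idx m) x * G x) :
    (u, v) ∈ (p.opA m).graph := by
  rw [p.mem_graph_opA]
  refine ⟨G, G', hG, hu, ?_⟩
  filter_upwards [hv, ae_restrict_mem measurableSet_Ioo] with x hvx hx
  rw [hvx, hp.superpot_eq m hx]

theorem exists_mem_graph_opA_of_mem_testVectors (hp : p.IsAdmissible) (m : ℕ) :
    ∀ u ∈ testVectors p.L, ∃ v ∈ testVectors p.L, (u, v) ∈ (p.opA m).graph := by
  rintro u ⟨φ, hφ, hu⟩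
  have ht := hφ.const_mul_deriv_add_cotPotential_mul (p.idx m) p.hbar
  exact ⟨_, ht.toLp_mem_testVectors,
    hp.mem_graph_opA_of_hasACDeriv m hφ.hasACDeriv hu ht.memLp.coeFn_toLp⟩

theorem dense_domain_opLambda (hp : p.IsAdmissible) (m n : ℕ) :
    Dense ((p.opLambda m n).domain : Set (Hilb p.L)) := by
  refine dense_of_testVectors_subset (subset_domain_opProd _ ?_)
  simp only [List.forall_mem_map]
  exact fun k _ => hp.exists_mem_graph_opA_of_mem_testVectors k

theorem dense_domain_opA (hp : p.IsAdmissible) (m : ℕ) :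
    Dense ((p.opA m).domain : Set (Hilb p.L)) :=
  dense_of_testVectors_subset fun u hu =>
    let ⟨_, _, h⟩ := hp.exists_mem_graph_opA_of_mem_testVectors m u hu
    LinearPMap.mem_domain_of_mem_graph h

theorem mem_graph_adjoint_opA_of_vanishesLinearly (hp : p.IsAdmissible) (m : ℕ) {G G' : ℝ → ℂ}
    {y z : Hilb p.L} (hG : HasACDeriv p.L G G') (hG0 : VanishesLinearly p.L G)
    (hy : y =ᵐ[mu p.L] G)
    (hz : z =ᵐ[mu p.L] fun x => -(p.hbar : ℂ) * G' x + p.cotPotential (p.idx m) x * G x) :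
    (y, z) ∈ (p.opA m).adjoint.graph := by
  refine (mem_graph_adjoint (hp.dense_domain_opA m)).2 fun u v huv => ?_
  refine inner_eq_of_mem_graphA hp.L_pos hp.hbar_ne_zero (fun x hx => ?_) hG hG0
    ((p.mem_graph_opA m _).1 huv) hy ?_
  · rw [hp.superpot_eq m hx, Complex.conj_ofReal]
  · filter_upwards [hz, ae_restrict_mem measurableSet_Ioo] with x hzx hx
    rw [hzx, hp.superpot_eq m hx]

theorem dense_domain_opTheta (hp : p.IsAdmissible) (n m : ℕ) :
    Dense ((p.opTheta n m).domain : Set (Hilb p.L)) := by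
  refine dense_of_testVectors_subset (subset_domain_opProd _ ?_)
  simp only [List.forall_mem_map]
  rintro k - u ⟨φ, hφ, hu⟩
  have ht := hφ.const_mul_deriv_add_cotPotential_mul (p.idx k) (-p.hbar)
  exact ⟨_, ht.toLp_mem_testVectors, hp.mem_graph_adjoint_opA_of_vanishesLinearly k hφ.hasACDeriv
    hφ.vanishesLinearly hu ht.memLp.coeFn_toLp⟩

theorem isFormalAdjoint_opLambda_opTheta (hp : p.IsAdmissible) (m n : ℕ) :
    (p.opLambda m n).IsFormalAdjoint (p.opTheta m n) := by
  have h := isFormalAdjoint_opProd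
    (fun k => (LinearPMap.adjoint_isFormalAdjoint (hp.dense_domain_opA k)).symm)
    (List.Ico (m + 1) (n + 1)).reverse
  rwa [List.reverse_reverse] at h

theorem opTheta_le_adjoint_opLambda (hp : p.IsAdmissible) (m n : ℕ) :
    p.opTheta m n ≤ (p.opLambda m n).adjoint :=
  (hp.isFormalAdjoint_opLambda_opTheta m n).le_adjoint (hp.dense_domain_opLambda m n)

theorem opLambda_le_adjoint_opTheta (hp : p.IsAdmissible) (m n : ℕ) :
    p.opLambda m n ≤ (p.opTheta m n).adjoint :=
  (hp.isFormalAdjoint_opLambda_opTheta m n).symm.le_adjoint (hp.dense_domain_opTheta m n)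

end Params.IsAdmissible

end Domains

/-! ### Mean values -/

section MeanValues

variable {p : Params}

theorem Params.hasACDeriv_profile (p : Params) (S : ℝ) (Q : Polynomial ℂ) :
    HasACDeriv p.L (p.profile S Q)
      fun x => (Real.pi / p.L : ℝ) * p.profile S (derivPoly (p.beta : ℂ) (S : ℂ) Q) x :=
  hasACDeriv_of_hasDerivAt (fun _ hx => p.hasDerivAt_profile S Q hx)
    (continuousOn_const.mul (p.continuousOn_profile S _))

theorem Params.constN_eq_gapProd (hnu : -1 < p.nu) (n m : ℕ) :
    p.constN n m = p.gapProd (m + 1) (n + (n + 1)) := by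
  refine Finset.prod_congr rfl fun k _ => ?_
  rw [p.gap_eq_mul hnu]
  simp only [Params.idx]
  push_cast
  ring_nf

theorem Params.constM_eq_sqrt_gapProd (hnu : -1 < p.nu) (n m : ℕ) :
    p.constM n m = √(p.gapProd (m + 1) (n + (m + 1))) := by
  refine congrArg Real.sqrt (Finset.prod_congr rfl fun k _ => ?_)
  rw [p.gap_eq_mul hnu]
  simp only [Params.idx]
  push_cast
  ring_nf

theorem Params.prod_Ico_gap (hnu : -1 < p.nu) {a b j : ℕ} (hab : a ≤ b) (haj : a ≤ j) :
    ∏ k ∈ Finset.Ico a b, p.gap k j = p.gapProd b j * (p.gapProd a j)⁻¹ :=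
  (eq_mul_inv_iff_mul_eq₀ (p.gapProd_pos hnu haj).ne').2
    ((mul_comm _ _).trans (Finset.prod_range_mul_prod_Ico _ hab))

theorem Params.constN_mul_inv (hnu : -1 < p.nu) {a b n : ℕ} (hab : a ≤ b) (han : a ≤ n + n) :
    p.constN n b * (p.constN n a)⁻¹ =
      ∏ k ∈ Finset.Ico (a + 1) (b + 1), p.gap k (n + (n + 1)) := by
  have ha : a + 1 ≤ n + (n + 1) := Nat.succ_le_succ han
  rw [p.prod_Ico_gap hnu (Nat.succ_le_succ hab) ha, p.constN_eq_gapProd hnu,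
    p.constN_eq_gapProd hnu]

theorem Params.constM_mul_inv_sq (hnu : -1 < p.nu) {m n : ℕ} (h : m ≤ n) :
    (p.constM m n * (p.constM n m)⁻¹) ^ 2 =
      ∏ k ∈ Finset.Ico (m + 1) (n + 1), p.gap k (n + (m + 1)) := by
  have hm : m + 1 ≤ n + (m + 1) := Nat.le_add_left _ _
  have hn : n + 1 ≤ n + (m + 1) := Nat.add_le_add_left (Nat.le_add_left _ _) n
  rw [p.prod_Ico_gap hnu (Nat.succ_le_succ h) hm, p.constM_eq_sqrt_gapProd hnu,
    p.constM_eq_sqrt_gapProd hnu, add_left_comm m n 1, mul_pow, inv_pow,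
    Real.sq_sqrt (p.gapProd_pos hnu hn).le, Real.sq_sqrt (p.gapProd_pos hnu hm).le]

theorem Params.constN_self (hnu : -1 < p.nu) (n : ℕ) : p.constN n n = p.constM n n ^ 2 := by
  rw [p.constN_eq_gapProd hnu, p.constM_eq_sqrt_gapProd hnu,
    Real.sq_sqrt (p.gapProd_pos hnu (Nat.le_add_left _ _)).le]

namespace Params.IsAdmissible

theorem mem_graph_opA_ladderVec (hp : p.IsAdmissible) (m j : ℕ) :
    (p.ladderVec hp.neg_one_lt_nu m j,
      (p.scale : ℂ) • p.ladderVec hp.neg_one_lt_nu (m + 1) j) ∈ (p.opA m).graph := by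
  have hnu := hp.neg_one_lt_nu
  refine hp.mem_graph_opA_of_hasACDeriv m (p.hasACDeriv_profile _ _) (p.coeFn_ladderVec hnu m j) ?_
  filter_upwards [Lp.coeFn_smul (p.scale : ℂ) (p.ladderVec hnu (m + 1) j),
    p.coeFn_ladderVec hnu (m + 1) j] with x hsmul hx
  rw [hsmul, Pi.smul_apply, hx, smul_eq_mul, p.profile_lowerPoly, Params.ladderPoly]

theorem mem_graph_adjoint_opA_ladderVec (hp : p.IsAdmissible) (m j : ℕ) :
    (p.ladderVec hp.neg_one_lt_nu (m + 1) j,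
      (p.scale * p.gap m j : ℂ) • p.ladderVec hp.neg_one_lt_nu m j) ∈ (p.opA m).adjoint.graph := by
  have hnu := hp.neg_one_lt_nu
  refine hp.mem_graph_adjoint_opA_of_vanishesLinearly m (p.hasACDeriv_profile _ _)
    (p.vanishesLinearly_ladder_succ hnu m j) (p.coeFn_ladderVec hnu (m + 1) j) ?_
  filter_upwards [Lp.coeFn_smul (p.scale * p.gap m j : ℂ) (p.ladderVec hnu m j),
    p.coeFn_ladderVec hnu m j] with x hsmul hx
  rw [hsmul, Pi.smul_apply, hx, smul_eq_mul, p.profile_raisePoly, p.raisePoly_ladderPoly_succ hnu,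
    p.profile_smul, mul_assoc]

theorem norm_sq_ladderVec_succ (hp : p.IsAdmissible) (m j : ℕ) :
    ‖p.ladderVec hp.neg_one_lt_nu (m + 1) j‖ ^ 2 =
      p.gap m j * ‖p.ladderVec hp.neg_one_lt_nu m j‖ ^ 2 := by
  have hinner := (mem_graph_adjoint (hp.dense_domain_opA m)).1
    (hp.mem_graph_adjoint_opA_ladderVec m j) _ _ (hp.mem_graph_opA_ladderVec m j)
  rw [inner_smul_left, inner_smul_right, Complex.conj_ofReal, mul_assoc,
    inner_self_eq_norm_sq_to_K, inner_self_eq_norm_sq_to_K] at hinner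
  exact Complex.ofReal_injective <| by
    simpa only [Complex.ofReal_mul, Complex.ofReal_pow, Complex.coe_algebraMap] using
      mul_left_cancel₀ (Complex.ofReal_ne_zero.2 hp.scale_ne_zero) hinner

theorem norm_sq_ladderVec (hp : p.IsAdmissible) (m j : ℕ) :
    ‖p.ladderVec hp.neg_one_lt_nu m j‖ ^ 2 =
      p.gapProd m j * ‖p.ladderVec hp.neg_one_lt_nu 0 j‖ ^ 2 := by
  induction m with
  | zero => rw [Params.gapProd, Finset.prod_range_zero, one_mul]
  | succ m ih =>
    rw [hp.norm_sq_ladderVec_succ, ih, Params.gapProd, Params.gapProd, Finset.prod_range_succ,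
      mul_left_comm, mul_assoc]

theorem norm_smul_ladderVec (hp : p.IsAdmissible) {m j : ℕ} (h : m ≤ j) :
    ‖((p.normConst j * p.scale ^ m / p.hierNorm m j : ℝ) : ℂ) •
      p.ladderVec hp.neg_one_lt_nu m j‖ = 1 := by
  have hnu := hp.neg_one_lt_nu
  have hvec := norm_ne_zero_iff.2 (p.ladderVec_ne_zero hp.L_pos hnu j.zero_le)
  have hgap := (p.gapProd_pos hnu h).ne'
  have hscale := pow_ne_zero m hp.scale_ne_zero
  refine (sq_eq_sq₀ (norm_nonneg _) zero_le_one).1 ?_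
  rw [norm_smul, mul_pow, Complex.norm_real, Real.norm_eq_abs, sq_abs, hp.norm_sq_ladderVec,
    p.normConst_eq hp.L_pos hnu, div_pow, p.hierNorm_eq hp.mass_ne_zero,
    Real.sq_sqrt (mul_nonneg (sq_nonneg _) (p.gapProd_pos hnu h).le)]
  field_simp

theorem hasMean_hierEigenfun (hp : p.IsAdmissible) {X : Hilb p.L →ₗ.[ℂ] Hilb p.L} {m n : ℕ} {c : ℂ}
    (h : (p.ladderVec hp.neg_one_lt_nu m (n + m), c • p.ladderVec hp.neg_one_lt_nu m (n + m)) ∈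
      X.graph) :
    HasMean X (p.hierEigenfun m n) c := by
  have hnu := hp.neg_one_lt_nu
  have hunit := hp.norm_smul_ladderVec (Nat.le_add_left m n)
  set κ : ℂ := ((p.normConst (n + m) * p.scale ^ m / p.hierNorm m (n + m) : ℝ) : ℂ) with hκ
  refine hasMean_of_smul_mem_graph (u := κ • p.ladderVec hnu m (n + m)) ?_ hunit ?_
  · filter_upwards [Lp.coeFn_smul κ (p.ladderVec hnu m (n + m)), p.coeFn_ladderVec hnu m (n + m),
      ae_restrict_mem measurableSet_Ioo] with x hsmul hvec hx
    rw [hsmul, Pi.smul_apply, hvec, smul_eq_mul, Params.hierEigenfun, hp.ladder_eq m (n + m) hx, hκ,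
      Complex.ofReal_div]
    ring
  · rw [smul_comm c κ]
    exact X.graph.smul_mem κ h

theorem mem_graph_opLambda_ladderVec (hp : p.IsAdmissible) {m n : ℕ} (h : m ≤ n) (j : ℕ) :
    (p.ladderVec hp.neg_one_lt_nu (m + 1) j,
      (p.scale ^ (n - m) : ℂ) • p.ladderVec hp.neg_one_lt_nu (n + 1) j) ∈
        (p.opLambda m n).graph := by
  have hchain := mem_graph_opProd_reverse_Ico (e := fun k => p.ladderVec hp.neg_one_lt_nu k j)
    (fun k => hp.mem_graph_opA_ladderVec k j) (Nat.succ_le_succ h)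
  rwa [Finset.prod_const, Nat.card_Ico, Nat.succ_sub_succ] at hchain

theorem mem_graph_opTheta_ladderVec (hp : p.IsAdmissible) {m n : ℕ} (h : m ≤ n) (j : ℕ) :
    (p.ladderVec hp.neg_one_lt_nu (n + 1) j,
      (p.scale ^ (n - m) * ∏ k ∈ Finset.Ico (m + 1) (n + 1), p.gap k j : ℂ) •
        p.ladderVec hp.neg_one_lt_nu (m + 1) j) ∈ (p.opTheta m n).graph := by
  have hchain := mem_graph_opProd_Ico (e := fun k => p.ladderVec hp.neg_one_lt_nu k j)
    (fun k => hp.mem_graph_adjoint_opA_ladderVec k j) (Nat.succ_le_succ h)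
  rwa [Finset.prod_mul_distrib, Finset.prod_const, Nat.card_Ico, Nat.succ_sub_succ,
    ← Complex.ofReal_prod] at hchain

theorem hasMean_opMul_of_opLambda_le_of_opTheta_le (hp : p.IsAdmissible) {m n : ℕ} (h : m ≤ n)
    {T S : Hilb p.L →ₗ.[ℂ] Hilb p.L} (hT : p.opLambda m n ≤ T) (hS : p.opTheta m n ≤ S) (i : ℕ) :
    HasMean (opMul T S) (p.hierEigenfun (n + 1) i)
      (((p.scale ^ (n - m)) ^ 2 *
        ∏ k ∈ Finset.Ico (m + 1) (n + 1), p.gap k (i + (n + 1)) : ℝ) : ℂ) := by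
  refine hp.hasMean_hierEigenfun ?_
  convert smul_mem_graph_opMul
    (LinearPMap.le_graph_of_le hS (hp.mem_graph_opTheta_ladderVec h (i + (n + 1))))
    (LinearPMap.le_graph_of_le hT (hp.mem_graph_opLambda_ladderVec h (i + (n + 1)))) using 3
  push_cast
  ring

theorem hasMean_opMul_of_opTheta_le_of_opLambda_le (hp : p.IsAdmissible) {m n : ℕ} (h : m ≤ n)
    {S T : Hilb p.L →ₗ.[ℂ] Hilb p.L} (hS : p.opTheta m n ≤ S) (hT : p.opLambda m n ≤ T) (i : ℕ) :
    HasMean (opMul S T) (p.hierEigenfun (m + 1) i)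
      (((p.scale ^ (n - m)) ^ 2 *
        ∏ k ∈ Finset.Ico (m + 1) (n + 1), p.gap k (i + (m + 1)) : ℝ) : ℂ) := by
  refine hp.hasMean_hierEigenfun ?_
  convert smul_mem_graph_opMul
    (LinearPMap.le_graph_of_le hT (hp.mem_graph_opLambda_ladderVec h (i + (m + 1))))
    (LinearPMap.le_graph_of_le hS (hp.mem_graph_opTheta_ladderVec h (i + (m + 1)))) using 3
  push_cast
  ring

end Params.IsAdmissible

end MeanValues

end PoschlTeller

theorem corollary2_general (p : PoschlTeller.Params)
    (hhbar : p.hbar ≠ 0) (hmass : p.mass ≠ 0) (hL : 0 < p.L) (hnu : -1 < p.nu) :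
    (∀ n m : ℕ, m < n →
      PoschlTeller.HasMean
          (PoschlTeller.opMul (p.opLambda m n) (p.opLambda m n).adjoint)
          (p.hierEigenfun (n + 1) n)
          ((((p.hbar * Real.pi / p.L) ^ (n - m)) ^ 2 *
            (p.constN n n * (p.constN n m)⁻¹) : ℝ) : ℂ) ∧
      PoschlTeller.HasMean
          (PoschlTeller.opMul (p.opLambda m n).adjoint (p.opLambda m n))
          (p.hierEigenfun (m + 1) n)
          ((((p.hbar * Real.pi / p.L) ^ (n - m) *
            (p.constM m n * (p.constM n m)⁻¹)) ^ 2 : ℝ) : ℂ)) ∧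
    (∀ n m : ℕ, n < m →
      PoschlTeller.HasMean
          (PoschlTeller.opMul (p.opTheta n m) (p.opTheta n m).adjoint)
          (p.hierEigenfun (n + 1) n)
          ((((p.hbar * Real.pi / p.L) ^ (m - n)) ^ 2 *
            ((p.constN n n)⁻¹ * p.constN n m) : ℝ) : ℂ) ∧
      PoschlTeller.HasMean
          (PoschlTeller.opMul (p.opTheta n m).adjoint (p.opTheta n m))
          (p.hierEigenfun (m + 1) n)
          ((((p.hbar * Real.pi / p.L) ^ (m - n) *
            (p.constM n m * (p.constM m n)⁻¹)) ^ 2 : ℝ) : ℂ)) ∧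
    (∀ n : ℕ, p.constN n n = p.constM n n ^ 2) := by
  have hp : p.IsAdmissible := ⟨hhbar, hmass, hL, hnu⟩
  refine ⟨fun n m h => ⟨?_, ?_⟩, fun n m h => ⟨?_, ?_⟩, p.constN_self hnu⟩
  · rw [p.constN_mul_inv hnu h.le (by lia)]
    exact hp.hasMean_opMul_of_opLambda_le_of_opTheta_le h.le le_rfl
      (hp.opTheta_le_adjoint_opLambda m n) n
  · rw [mul_pow, p.constM_mul_inv_sq hnu h.le]
    exact hp.hasMean_opMul_of_opTheta_le_of_opLambda_le h.le
      (hp.opTheta_le_adjoint_opLambda m n) le_rfl n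
  · rw [mul_comm (p.constN n n)⁻¹, p.constN_mul_inv hnu h.le (by lia)]
    exact hp.hasMean_opMul_of_opTheta_le_of_opLambda_le h.le le_rfl
      (hp.opLambda_le_adjoint_opTheta n m) n
  · rw [mul_pow, p.constM_mul_inv_sq hnu h.le, add_left_comm m n 1]
    exact hp.hasMean_opMul_of_opLambda_le_of_opTheta_le h.le
      (hp.opLambda_le_adjoint_opTheta n m) le_rfl n

theorem corollary2 (p : PoschlTeller.Params)
    (hhbar : 0 < p.hbar) (hmass : 0 < p.mass) (hL : 0 < p.L)
    (hnu : 0 ≤ p.nu) (hbeta : 0 ≤ p.beta) :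
    (∀ n m : ℕ, m < n →
      PoschlTeller.HasMean
          (PoschlTeller.opMul (p.opLambda m n) (p.opLambda m n).adjoint)
          (p.hierEigenfun (n + 1) n)
          ((((p.hbar * Real.pi / p.L) ^ (n - m)) ^ 2 *
            (p.constN n n * (p.constN n m)⁻¹) : ℝ) : ℂ) ∧
      PoschlTeller.HasMean
          (PoschlTeller.opMul (p.opLambda m n).adjoint (p.opLambda m n))
          (p.hierEigenfun (m + 1) n)
          ((((p.hbar * Real.pi / p.L) ^ (n - m) *
            (p.constM m n * (p.constM n m)⁻¹)) ^ 2 : ℝ) : ℂ)) ∧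
    (∀ n m : ℕ, n < m →
      PoschlTeller.HasMean
          (PoschlTeller.opMul (p.opTheta n m) (p.opTheta n m).adjoint)
          (p.hierEigenfun (n + 1) n)
          ((((p.hbar * Real.pi / p.L) ^ (m - n)) ^ 2 *
            ((p.constN n n)⁻¹ * p.constN n m) : ℝ) : ℂ) ∧
      PoschlTeller.HasMean
          (PoschlTeller.opMul (p.opTheta n m).adjoint (p.opTheta n m))
          (p.hierEigenfun (m + 1) n)
          ((((p.hbar * Real.pi / p.L) ^ (m - n) *
            (p.constM n m * (p.constM m n)⁻¹)) ^ 2 : ℝ) : ℂ)) ∧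
    (∀ n : ℕ, p.constN n n = p.constM n n ^ 2) :=
  corollary2_general p hhbar.ne' hmass.ne' hL (neg_one_lt_zero.trans_le hnu)
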